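/- Fix constants $\Lambda\in\mathbb R$ and $c>0$. An $r$-local instance of quantum MAX-CSP with $m$ terms on $n$ qubits is a list of terms $H_e = M_e|_{T_e}\otimes \mathrm{Id}_{[n]\setminus T_e}$, $e\in E=[m]$, where $T_e$ is a sequence of $r$ distinct qubits and $M_e\in\mathbb C^{2^r\times 2^r}$ is Hermitian positive semidefinite. Put $\mathcal H=\sum_{e\in E}H_e$ and, for a Hamiltonian $\mathcal A$ on $n$ qubits, $\mathrm{OPT}(\mathcal A)=\max_{\|\psi\|_2=1}\langle\psi|\mathcal A|\psi\rangle$. There is a constant $C$ depending only on $\Lambda$ and $c$ such that the following holds for all $r,n,m$, every such instance in which all eigenvalues of every $M_e$ are at most $\Lambda$ and $\mathrm{OPT}(\mathcal H)\ge c\,m$, and every $\varepsilon>0$. There are a set $L\subseteq E$ with $|L|\le C\varepsilon^{-2}n$ and weights $\tilde w:L\to\mathbb R_{\ge 0}$ such that, with $\tilde{\mathcal H}=\sum_{e\in L}\tilde w(e)H_e$, every unit vector $|\psi\rangle$ with $$\langle\psi|\tilde{\mathcal H}|\psi\rangle\ \ge\ (1-\varepsilon)\,\mathrm{OPT}(\tilde{\mathcal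 H})$$ also satisfies $$\langle\psi|\mathcal H|\psi\rangle\ \ge\ (1-2\varepsilon)\,\mathrm{OPT}(\mathcal H).$$ Moreover, such $L,\tilde w$ can be found efficiently by a classical randomized algorithm: there is a single program (depending only on $\Lambda$ and $c$) for a real random access machine with fair coin flips (unit-cost exact real arithmetic and comparisons, integer addition and subtraction, no rounding of reals to integers, rational constants) and a polynomial $p$, such that on input $n,m,r,\varepsilon$, the sequences $T_e$ and the entries of the matrices $M_e$, the program always halts within $p(n,m)$ steps and, with probability at least $1-2^{-n}$ over its coin flips, outputs $L,\tilde w$ with all the properties above. -/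

import Mathlib

open scoped Matrix ComplexOrder

noncomputable section

namespace QuantumMaxCSP

/-! ### Local Hamiltonians on qubits -/

/-- The Hilbert space of `n` qubits, with orthonormal basis indexed by bit strings. -/
abbrev Qubits (n : ℕ) : Type := EuclideanSpace ℂ (Fin n → Fin 2)

/-- An `r`-local term on `n` qubits: a PSD matrix of arity `r`, together with the sequence of `r`
distinct qubits on which it acts. -/
structure LocalTerm (n r : ℕ) where
  qubits : Fin r ↪ Fin n
  mat : Matrix (Fin r → Fin 2) (Fin r → Fin 2) ℂ
  posSemidef : mat.PosSemidef

/-- The operator `M|_T ⊗ Id_{[n] \ T}` on `n` qubits, as a matrix in the bit string basis. -/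
def LocalTerm.op {n r : ℕ} (t : LocalTerm n r) : Matrix (Fin n → Fin 2) (Fin n → Fin 2) ℂ :=
  open Classical in
  Matrix.of fun x y =>
    if ∀ q, q ∉ Set.range t.qubits → x q = y q then
      t.mat (fun j => x (t.qubits j)) (fun j => y (t.qubits j))
    else 0

/-- An `r`-local instance of quantum MAX-CSP with `m` terms on `n` qubits. -/
abbrev Instance (n r m : ℕ) : Type := Fin m → LocalTerm n r

/-- Every eigenvalue of every predicate matrix is at most `Λ`. -/
def EigenvaluesLE {n r m : ℕ} (H : Instance n r m) (Λ : ℝ) : Prop :=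
  ∀ i k, (H i).posSemidef.isHermitian.eigenvalues k ≤ Λ

/-- The Hamiltonian `∑_{e ∈ L} w(e) H_e`. -/
def weightedHam {n r m : ℕ} (H : Instance n r m) (L : Finset (Fin m)) (w : Fin m → ℝ) :
    Matrix (Fin n → Fin 2) (Fin n → Fin 2) ℂ :=
  ∑ i ∈ L, (w i : ℂ) • (H i).op

/-- The Hamiltonian `∑_e H_e` of the instance. -/
def ham {n r m : ℕ} (H : Instance n r m) : Matrix (Fin n → Fin 2) (Fin n → Fin 2) ℂ :=
  ∑ i, (H i).op

/-- The energy `⟨ψ| A |ψ⟩` (a real number when `A` is Hermitian). -/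
def energy {n : ℕ} (A : Matrix (Fin n → Fin 2) (Fin n → Fin 2) ℂ) (ψ : Qubits n) : ℝ :=
  (inner ℂ ψ (Matrix.toEuclideanCLM (𝕜 := ℂ) A ψ)).re

/-- The maximum energy of `A` over unit vectors. -/
def opt {n : ℕ} (A : Matrix (Fin n → Fin 2) (Fin n → Fin 2) ℂ) : ℝ :=
  sSup (energy A '' {ψ : Qubits n | ‖ψ‖ = 1})

/-- The supremum defining `opt` is a maximum. -/
theorem isGreatest_opt {n : ℕ} (A : Matrix (Fin n → Fin 2) (Fin n → Fin 2) ℂ) :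
    IsGreatest (energy A '' {ψ : Qubits n | ‖ψ‖ = 1}) (opt A) := by
  have hset : {ψ : Qubits n | ‖ψ‖ = 1} = Metric.sphere (0 : Qubits n) 1 := by
    ext ψ; simp
  have hc : IsCompact {ψ : Qubits n | ‖ψ‖ = 1} := by
    rw [hset]; exact isCompact_sphere _ _
  have hne : {ψ : Qubits n | ‖ψ‖ = 1}.Nonempty :=
    ⟨EuclideanSpace.single (fun _ => 0) 1, by simp⟩
  have hcont : Continuous (energy A) := by
    unfold energy
    fun_prop
  exact (hc.image hcont).isGreatest_sSup (hne.image _)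

/-- The reweighted subset `(L, w)` of the terms of `H` has nonnegative weights, at most `C n / ε²`
terms, and every `(1 - ε)`-optimal state for it is `(1 - 2ε)`-optimal for `H`. -/
def IsSparsifier {n r m : ℕ} (H : Instance n r m) (C ε : ℝ) (L : Finset (Fin m))
    (w : Fin m → ℝ) : Prop :=
  (∀ i ∈ L, 0 ≤ w i) ∧ (L.card : ℝ) ≤ C * n / ε ^ 2 ∧
    ∀ ψ : Qubits n, ‖ψ‖ = 1 →
      (1 - ε) * opt (weightedHam H L w) ≤ energy (weightedHam H L w) ψ →
      (1 - 2 * ε) * opt (ham H) ≤ energy (ham H) ψ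

end QuantumMaxCSP

/-! ### Randomized real random access machines

Integer registers, integer arrays and real arrays. Each step costs one unit of time and performs
one operation: integer addition or subtraction, a read or write through an index register, exact
real arithmetic, a comparison, or a fair coin flip. Programs are finite and contain only rational
constants; there is no rounding of reals to integers. -/

namespace RealRAM

/-- Memory contents, together with the number of coins used so far. -/
structure Store where
  reg : ℕ → ℕ
  nat : ℕ → ℕ → ℕ
  real : ℕ → ℕ → ℝ
  coins : ℕ

/-- The cell of the array `arr` whose position is the content of the register `idx`. -/
structure Loc where
  arr : ℕ
  idx : ℕ

inductive RealOp
  | add | sub | mul | div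

def RealOp.eval : RealOp → ℝ → ℝ → ℝ
  | .add, x, y => x + y
  | .sub, x, y => x - y
  | .mul, x, y => x * y
  | .div, x, y => x / y

inductive Instr
  | setReg (d k : ℕ)
  | addReg (d a b : ℕ)
  | subReg (d a b : ℕ)
  | loadNat (d : ℕ) (l : Loc)
  | storeNat (l : Loc) (a : ℕ)
  | setReal (l : Loc) (q : ℚ)
  | ofReg (l : Loc) (a : ℕ)
  | copyReal (l a : Loc)
  | opReal (o : RealOp) (l a b : Loc)
  | flip (d : ℕ)

inductive Test
  | regLt (a b : ℕ)
  | realLt (a b : Loc)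
  | neg (t : Test)

inductive Program
  | skip
  | instr (i : Instr)
  | seq (p q : Program)
  | ite (t : Test) (p q : Program)
  | loop (t : Test) (p : Program)

namespace Store

def setReg (s : Store) (d v : ℕ) : Store :=
  { s with reg := Function.update s.reg d v }

def getNat (s : Store) (l : Loc) : ℕ := s.nat l.arr (s.reg l.idx)

def setNat (s : Store) (l : Loc) (v : ℕ) : Store :=
  { s with nat := Function.update s.nat l.arr (Function.update (s.nat l.arr) (s.reg l.idx) v) }

def getReal (s : Store) (l : Loc) : ℝ := s.real l.arr (s.reg l.idx)

def setReal (s : Store) (l : Loc) (v : ℝ) : Store :=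
  { s with real := Function.update s.real l.arr (Function.update (s.real l.arr) (s.reg l.idx) v) }

end Store

/-- The effect of an instruction; `ω k` is the outcome of the `k`-th coin flip. -/
def Instr.exec (ω : ℕ → Bool) (s : Store) : Instr → Store
  | .setReg d k => s.setReg d k
  | .addReg d a b => s.setReg d (s.reg a + s.reg b)
  | .subReg d a b => s.setReg d (s.reg a - s.reg b)
  | .loadNat d l => s.setReg d (s.getNat l)
  | .storeNat l a => s.setNat l (s.reg a)
  | .setReal l q => s.setReal l (q : ℝ)
  | .ofReg l a => s.setReal l (s.reg a : ℝ)
  | .copyReal l a => s.setReal l (s.getReal a)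
  | .opReal o l a b => s.setReal l (o.eval (s.getReal a) (s.getReal b))
  | .flip d => { s.setReg d (if ω s.coins then 1 else 0) with coins := s.coins + 1 }

def Test.Holds (s : Store) : Test → Prop
  | .regLt a b => s.reg a < s.reg b
  | .realLt a b => s.getReal a < s.getReal b
  | .neg t => ¬ t.Holds s

/-- The program fragments that remain to be executed, and the memory. -/
structure Config where
  todo : List Program
  store : Store

open Classical in
/-- One unit of time. A configuration with nothing left to execute is halted. -/
def step (ω : ℕ → Bool) : Config → Config
  | ⟨[], s⟩ => ⟨[], s⟩
  | ⟨.skip :: K, s⟩ => ⟨K, s⟩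
  | ⟨.instr i :: K, s⟩ => ⟨K, i.exec ω s⟩
  | ⟨.seq p q :: K, s⟩ => ⟨p :: q :: K, s⟩
  | ⟨.ite t p q :: K, s⟩ => if t.Holds s then ⟨p :: K, s⟩ else ⟨q :: K, s⟩
  | ⟨.loop t p :: K, s⟩ => if t.Holds s then ⟨p :: .loop t p :: K, s⟩ else ⟨K, s⟩

/-- The configuration after `T` steps when the coins come up as in `ω`. In `T` steps at most `T`
coins are flipped, so the padding of `ω` is never read. -/
def run (P : Program) (s : Store) (T : ℕ) (ω : Fin T → Bool) : Config :=
  (step fun k => if h : k < T then ω ⟨k, h⟩ else false)^[T] ⟨[P], s⟩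

def Config.Halted (c : Config) : Prop := c.todo = []

/-- Started on `s`, the program `P` halts within `T` steps for all outcomes of its coin flips, and
with probability at least `p` over fair independent coin flips its final memory satisfies `good`. -/
def SolvesInTime (P : Program) (s : Store) (T : ℕ) (p : ℝ) (good : Store → Prop) : Prop :=
  (∀ ω : Fin T → Bool, (run P s T ω).Halted) ∧
    p ≤ (Nat.card {ω : Fin T → Bool // good (run P s T ω).store} : ℝ) / 2 ^ T

end RealRAM

namespace QuantumMaxCSP

/-- The entries of the predicate matrices of an instance, listed term by term and row by row; bit
strings are numbered through `finFunctionFinEquiv`. -/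
def entries {n r m : ℕ} (H : Instance n r m) (k : ℕ) : ℂ :=
  if h : k < m * (2 ^ r * 2 ^ r) then
    let ip := finProdFinEquiv.symm (⟨k, h⟩ : Fin (m * (2 ^ r * 2 ^ r)))
    let ab := finProdFinEquiv.symm ip.2
    (H ip.1).mat (finFunctionFinEquiv.symm ab.1) (finFunctionFinEquiv.symm ab.2)
  else 0

/-- The qubits of the terms of an instance, listed term by term. -/
def qubitList {n r m : ℕ} (H : Instance n r m) (k : ℕ) : ℕ :=
  if h : k < m * r then
    let ij := finProdFinEquiv.symm (⟨k, h⟩ : Fin (m * r))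
    ((H ij.1).qubits ij.2 : ℕ)
  else 0

/-- The input of the algorithm. Registers `0, 1, 2` hold `n, m, r`; integer array `0` holds the
qubits of the terms; real array `0` holds `ε`, real arrays `1` and `2` hold the real and imaginary
parts of the matrix entries. All other memory is zero. -/
def input {n r m : ℕ} (H : Instance n r m) (ε : ℝ) : RealRAM.Store where
  reg
    | 0 => n
    | 1 => m
    | 2 => r
    | _ => 0
  nat
    | 0 => qubitList H
    | _ => fun _ => 0
  real
    | 0 => fun k => if k = 0 then ε else 0
    | 1 => fun k => (entries H k).re
    | 2 => fun k => (entries H k).im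
    | _ => fun _ => 0
  coins := 0

/-- The output of the algorithm: the weights stored in the first `m` cells of real array `3`. -/
def outputWeights (m : ℕ) (s : RealRAM.Store) (i : Fin m) : ℝ := s.real 3 i

/-- The output subset: the terms with nonzero output weight. -/
def outputSet (m : ℕ) (s : RealRAM.Store) : Finset (Fin m) :=
  {i | outputWeights m s i ≠ 0}

end QuantumMaxCSP

end

noncomputable section

namespace QuantumMaxCSP

/-! ### Traces of powers of Hermitian matrices -/

/-! Keep each term independently with probability `p = 2⁻ᵏ` and give the survivors weight `2ᵏ`, with
`k` chosen so that the expected sample size `p m` lies between `τ / 2` and `τ`, where `τ` is a large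
constant times `n / ε²`; if `m ≤ τ` already, keep everything. If the deviation `D = ∑ (w i - 1) H_i`
has all energies at most `ε c m / 2 ≤ (ε / 2) OPT` in absolute value, then a `(1 - ε)`-optimal state
of the sample has true energy at least `((1 - ε) (1 - ε / 2) - ε / 2) OPT ≥ (1 - 2 ε) OPT`. So a
matrix Chernoff bound is needed (`card_large_deviation_le`), together with a scalar tail bound for
the sample size (`card_support_sampleWeights_large_le`).

The Chernoff bound controls the mean of `Tr cosh (θ D)` by adding one term at a time, without
Golden–Thompson or Lieb. Along a line, `g u = Tr cosh (S + u A)` with `A² ≤ Λ²` satisfies `g'' ≤ Λ²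
g` (`coshTrace_line_derivs`), so `g` lies below the combination of `exp (± Λ u)` with the same value
and slope at `0`. Averaging over a centred random `u` then costs only a factor `exp (Λ² 𝔼 u²)`
(`sum_weight_le_of_deriv2_le`). Starting from `Tr cosh 0 = 2ⁿ`, Markov's inequality finishes. Taylor
polynomials replace `cosh` throughout, so only traces of powers occur; the limit is taken at the
end, in a scalar inequality.

The machine cannot round reals, so it finds `k` by halving: as long as the expected size exceeds
`τ`, every weight is doubled or deleted by a coin flip. The number of halvings does not depend on
the coins, so the event of success depends on a fixed block of `k m` coins and its probability is a
count. For `ε ≥ 1 / 2` the conclusion is vacuous and the empty sample serves. For `n > 0`, existence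
of a sparsifier follows from positive success probability. -/

theorem isHermitian_line {ι : Type*} {S A : Matrix ι ι ℂ} (hS : S.IsHermitian) (hA : A.IsHermitian)
    (u : ℝ) : (S + (u : ℂ) • A).IsHermitian := by
  refine hS.add ?_
  rw [Matrix.IsHermitian, Matrix.conjTranspose_smul, hA.eq]
  simp

section Trace

variable {ι : Type*} [Fintype ι] [DecidableEq ι]

theorem exists_unitary_diagonalization {H : Matrix ι ι ℂ} (hH : H.IsHermitian) :
    ∃ U : Matrix ι ι ℂ, Uᴴ * U = 1 ∧ U * Uᴴ = 1 ∧
      ∀ k, H ^ k = U * Matrix.diagonal (fun a => ((hH.eigenvalues a ^ k : ℝ) : ℂ)) * Uᴴ := by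
  refine ⟨hH.eigenvectorUnitary, ?_, ?_, fun k => ?_⟩
  · exact Unitary.coe_star_mul_self hH.eigenvectorUnitary
  · exact Unitary.coe_mul_star_self hH.eigenvectorUnitary
  · conv_lhs => rw [hH.spectral_theorem, ← map_pow, Matrix.diagonal_pow,
      Unitary.conjStarAlgAut_apply]
    congr 3
    ext a
    simp

theorem trace_pow_eq_sum_eigenvalues {H : Matrix ι ι ℂ} (hH : H.IsHermitian) (k : ℕ) :
    (H ^ k).trace.re = ∑ a, hH.eigenvalues a ^ k := by
  obtain ⟨U, h1, -, h⟩ := exists_unitary_diagonalization hH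
  rw [h k, Matrix.trace_mul_comm, ← mul_assoc, h1, one_mul, Matrix.trace_diagonal,
    Complex.re_sum]
  simp only [Complex.ofReal_re]

theorem trace_even_pow_nonneg {H : Matrix ι ι ℂ} (hH : H.IsHermitian) (k : ℕ) :
    0 ≤ (H ^ (2 * k)).trace.re := by
  rw [trace_pow_eq_sum_eigenvalues hH]
  exact Finset.sum_nonneg fun a _ => by rw [pow_mul]; positivity

/-- A rearrangement inequality: `|x| ^ j - |y| ^ j` and `|x| ^ l - |y| ^ l` have the same sign, and
expanding their nonnegative product gives the claim. Evenness of `j + l` removes the absolute values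
on the right. -/
theorem pow_mul_pow_add_pow_mul_pow_le (x y : ℝ) {j l k : ℕ} (h : j + l = 2 * k) :
    x ^ j * y ^ l + x ^ l * y ^ j ≤ x ^ (2 * k) + y ^ (2 * k) := by
  have hx : x ^ (2 * k) = |x| ^ j * |x| ^ l := by
    rw [← pow_add, h, pow_mul, pow_mul, sq_abs]
  have hy : y ^ (2 * k) = |y| ^ j * |y| ^ l := by
    rw [← pow_add, h, pow_mul, pow_mul, sq_abs]
  have h1 : x ^ j * y ^ l ≤ |x| ^ j * |y| ^ l := by
    rw [← abs_pow, ← abs_pow, ← abs_mul]; exact le_abs_self _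
  have h2 : x ^ l * y ^ j ≤ |x| ^ l * |y| ^ j := by
    rw [← abs_pow, ← abs_pow, ← abs_mul]; exact le_abs_self _
  have h3 : 0 ≤ (|x| ^ j - |y| ^ j) * (|x| ^ l - |y| ^ l) := by
    rcases le_total |x| |y| with hxy | hxy
    · exact mul_nonneg_of_nonpos_of_nonpos
        (sub_nonpos.2 (pow_le_pow_left₀ (abs_nonneg _) hxy _))
        (sub_nonpos.2 (pow_le_pow_left₀ (abs_nonneg _) hxy _))
    · exact mul_nonneg
        (sub_nonneg.2 (pow_le_pow_left₀ (abs_nonneg _) hxy _))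
        (sub_nonneg.2 (pow_le_pow_left₀ (abs_nonneg _) hxy _))
  rw [hx, hy]
  nlinarith

theorem trace_mul_diagonal_mul_diagonal {B : Matrix ι ι ℂ} (hB : B.IsHermitian) (f g : ι → ℝ) :
    (B * Matrix.diagonal (fun a => (f a : ℂ)) * (B * Matrix.diagonal fun a => (g a : ℂ))).trace.re
      = ∑ a, ∑ b, Complex.normSq (B a b) * (f b * g a) := by
  rw [Matrix.trace, Complex.re_sum]
  refine Finset.sum_congr rfl fun a _ => ?_
  rw [Matrix.diag_apply, Matrix.mul_apply, Complex.re_sum]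
  refine Finset.sum_congr rfl fun b _ => ?_
  rw [Matrix.mul_diagonal, Matrix.mul_diagonal]
  have h : B b a = (starRingEnd ℂ) (B a b) := (hB.apply b a).symm
  have h2 : B a b * (f b : ℂ) * (B b a * (g a : ℂ))
      = ((Complex.normSq (B a b) * (f b * g a) : ℝ) : ℂ) := by
    rw [h]; push_cast; rw [← Complex.mul_conj]; ring
  rw [h2, Complex.ofReal_re]

theorem sum_normSq_row_le {B : Matrix ι ι ℂ} (hB : B.IsHermitian) {Λ : ℝ}
    (hΛ : (((Λ ^ 2 : ℝ) : ℂ) • 1 - B * B).PosSemidef) (a : ι) :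
    ∑ b, Complex.normSq (B a b) ≤ Λ ^ 2 := by
  have h := hΛ.diag_nonneg (i := a)
  rw [Matrix.sub_apply, Matrix.smul_apply, Matrix.one_apply_eq, Matrix.mul_apply] at h
  have h2 : ∑ b, B a b * B b a = ((∑ b, Complex.normSq (B a b) : ℝ) : ℂ) := by
    push_cast
    refine Finset.sum_congr rfl fun b _ => ?_
    rw [← Complex.mul_conj, ← hB.apply b a]
    rfl
  rw [h2, smul_eq_mul, mul_one, ← Complex.ofReal_sub, Complex.zero_le_real] at h
  linarith

/-- In an eigenbasis of `H` the trace is a sum of `x b ^ j * x a ^ l` with the symmetric nonnegative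
weights `|B a b|²`. Symmetrising in `a, b` and rearranging moves all powers onto one eigenvalue, and
the row sums of the weights are diagonal entries of `B²`, hence at most `Λ²`. This replaces
commutation of `A` and `H` in the bound on the second derivative. -/
theorem trace_mul_pow_mul_mul_pow_le {H A : Matrix ι ι ℂ} (hH : H.IsHermitian)
    (hA : A.IsHermitian) {Λ : ℝ} (hΛ : (((Λ ^ 2 : ℝ) : ℂ) • 1 - A * A).PosSemidef)
    {j l k : ℕ} (h : j + l = 2 * k) :
    (A * H ^ j * (A * H ^ l)).trace.re ≤ Λ ^ 2 * (H ^ (2 * k)).trace.re := by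
  obtain ⟨U, h1, h2, hp⟩ := exists_unitary_diagonalization hH
  set D : ℕ → Matrix ι ι ℂ :=
    fun k => Matrix.diagonal (fun a => ((hH.eigenvalues a ^ k : ℝ) : ℂ)) with hD
  set B := Uᴴ * A * U with hBdef
  have hB : B.IsHermitian := Matrix.isHermitian_conjTranspose_mul_mul U hA
  have hBΛ : (((Λ ^ 2 : ℝ) : ℂ) • 1 - B * B).PosSemidef := by
    have := hΛ.conjTranspose_mul_mul_same U
    convert this using 1
    rw [Matrix.mul_sub, Matrix.sub_mul, Matrix.mul_smul, Matrix.smul_mul, mul_one, h1]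
    congr 1
    calc B * B = Uᴴ * A * (U * Uᴴ) * A * U := by rw [hBdef]; noncomm_ring
      _ = _ := by rw [h2]; noncomm_ring
  have key : (A * H ^ j * (A * H ^ l)).trace = (B * D j * (B * D l)).trace := by
    rw [hp j, hp l]
    calc (A * (U * D j * Uᴴ) * (A * (U * D l * Uᴴ))).trace
        = ((A * U * D j * Uᴴ * A * U * D l) * Uᴴ).trace := by congr 1; noncomm_ring
      _ = _ := by rw [Matrix.trace_mul_comm]; congr 1; rw [hBdef]; noncomm_ring
  rw [key, trace_mul_diagonal_mul_diagonal hB, trace_pow_eq_sum_eigenvalues hH]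
  set x := hH.eigenvalues
  have hsymm : ∀ a b, Complex.normSq (B a b) = Complex.normSq (B b a) := fun a b => by
    rw [← hB.apply a b]; exact Complex.normSq_conj _
  have hswap : ∑ a, ∑ b, Complex.normSq (B a b) * (x b ^ j * x a ^ l)
      = ∑ a, ∑ b, Complex.normSq (B a b) * (x a ^ j * x b ^ l) := by
    rw [Finset.sum_comm]
    exact Finset.sum_congr rfl fun a _ => Finset.sum_congr rfl fun b _ => by rw [hsymm]
  have hswap2 : ∑ a, ∑ b, Complex.normSq (B a b) * x b ^ (2 * k)
      = ∑ a, ∑ b, Complex.normSq (B a b) * x a ^ (2 * k) := by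
    rw [Finset.sum_comm]
    exact Finset.sum_congr rfl fun a _ => Finset.sum_congr rfl fun b _ => by rw [hsymm]
  have hle : ∑ a, ∑ b, Complex.normSq (B a b) * (x b ^ j * x a ^ l)
      + ∑ a, ∑ b, Complex.normSq (B a b) * (x a ^ j * x b ^ l)
      ≤ ∑ a, ∑ b, Complex.normSq (B a b) * x b ^ (2 * k)
        + ∑ a, ∑ b, Complex.normSq (B a b) * x a ^ (2 * k) := by
    simp only [← Finset.sum_add_distrib, ← mul_add]
    refine Finset.sum_le_sum fun a _ => Finset.sum_le_sum fun b _ => ?_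
    refine mul_le_mul_of_nonneg_left ?_ (Complex.normSq_nonneg _)
    have := pow_mul_pow_add_pow_mul_pow_le (x b) (x a) h
    linarith
  have hfin : ∑ a, ∑ b, Complex.normSq (B a b) * x a ^ (2 * k) ≤ Λ ^ 2 * ∑ a, x a ^ (2 * k) := by
    rw [Finset.mul_sum]
    refine Finset.sum_le_sum fun a _ => ?_
    rw [← Finset.sum_mul]
    exact mul_le_mul_of_nonneg_right (sum_normSq_row_le hB hBΛ a)
      (by rw [pow_mul]; positivity)
  linarith

/-! ### The trace of a truncated hyperbolic cosine -/

/-- The trace of the `2N`-th Taylor polynomial of `cosh` at a matrix. -/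
def coshTrace (N : ℕ) (H : Matrix ι ι ℂ) : ℝ :=
  ∑ k ∈ Finset.range N, (H ^ (2 * k)).trace.re / (2 * k).factorial

theorem coshTrace_nonneg (N : ℕ) {H : Matrix ι ι ℂ} (hH : H.IsHermitian) :
    0 ≤ coshTrace N H :=
  Finset.sum_nonneg fun k _ => div_nonneg (trace_even_pow_nonneg hH k) (by positivity)

theorem coshTrace_zero_le (N : ℕ) : coshTrace N (0 : Matrix ι ι ℂ) ≤ Fintype.card ι := by
  unfold coshTrace
  rcases N with _ | N
  · simp
  · rw [Finset.sum_range_succ']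
    simp [zero_pow]

open scoped Matrix.Norms.L2Operator in
-- The factor `X` is there to serve both derivatives: `X = 1` for the first and `X = A` for the
-- second.
theorem hasDerivAt_trace_mul_line_pow (X S A : Matrix ι ι ℂ) (k : ℕ) (u : ℝ) :
    HasDerivAt (fun u : ℝ => (X * (S + (u : ℂ) • A) ^ k).trace.re)
      (∑ i ∈ Finset.range k,
        (X * ((S + (u : ℂ) • A) ^ (k - 1 - i) * A * (S + (u : ℂ) • A) ^ i)).trace.re) u := by
  have hline : HasDerivAt (fun u : ℝ => S + (u : ℂ) • A) A u := by
    have h1 : HasDerivAt (fun u : ℝ => (u : ℂ)) 1 u := Complex.ofRealCLM.hasDerivAt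
    have := (h1.smul_const A).const_add S
    simpa using this
  have hpow := (hline.hasFDerivAt.pow' k)
  let T : Matrix ι ι ℂ →ₗ[ℝ] ℝ :=
    { toFun := fun M => (X * M).trace.re
      map_add' := fun a b => by simp [Matrix.mul_add]
      map_smul' := fun c a => by simp }
  have h3 := ((LinearMap.toContinuousLinearMap T).hasFDerivAt.comp u hpow).hasDerivAt
  refine h3.congr_deriv ?_
  simp [T, mul_assoc]

theorem hasDerivAt_trace_line_pow (S A : Matrix ι ι ℂ) (k : ℕ) (u : ℝ) :
    HasDerivAt (fun u : ℝ => ((S + (u : ℂ) • A) ^ k).trace.re)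
      (k * (A * (S + (u : ℂ) • A) ^ (k - 1)).trace.re) u := by
  have h := hasDerivAt_trace_mul_line_pow 1 S A k u
  simp only [one_mul] at h
  refine h.congr_deriv ?_
  rw [Finset.sum_congr rfl (g := fun _ => (A * (S + (u : ℂ) • A) ^ (k - 1)).trace.re)]
  · simp
  · intro i hi
    have hik : i + (k - 1 - i) = k - 1 := by have := Finset.mem_range.1 hi; omega
    -- Cyclicity of the trace makes all summands equal. This fails for the second derivative, where
    -- two copies of `A` are present.
    rw [Matrix.trace_mul_comm, ← mul_assoc, ← pow_add, hik, Matrix.trace_mul_comm]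

/-- Differentiating `Tr H ^ (2k+2) / (2k+2)!` twice gives `2k+1` mixed traces over `(2k+1)!`, each
at most `Λ² Tr H ^ (2k)`. So the series reproduces itself shifted by one, as for `cosh'' = cosh`. -/
theorem coshTrace_line_derivs {S A : Matrix ι ι ℂ} (hS : S.IsHermitian) (hA : A.IsHermitian)
    {Λ : ℝ} (hΛ : (((Λ ^ 2 : ℝ) : ℂ) • 1 - A * A).PosSemidef) (N : ℕ) :
    ∃ g₁ g₂ : ℝ → ℝ, (∀ u, HasDerivAt (fun u : ℝ => coshTrace N (S + (u : ℂ) • A)) (g₁ u) u) ∧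
      (∀ u, HasDerivAt g₁ (g₂ u) u) ∧
      ∀ u, g₂ u ≤ Λ ^ 2 * coshTrace N (S + (u : ℂ) • A) := by
  refine ⟨fun u => ∑ k ∈ Finset.range N,
      ((2 * k : ℕ) : ℝ) * (A * (S + (u : ℂ) • A) ^ (2 * k - 1)).trace.re / (2 * k).factorial,
    fun u => ∑ k ∈ Finset.range N, ((2 * k : ℕ) : ℝ) * (∑ i ∈ Finset.range (2 * k - 1),
      (A * ((S + (u : ℂ) • A) ^ (2 * k - 1 - 1 - i) * A * (S + (u : ℂ) • A) ^ i)).trace.re)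
        / (2 * k).factorial, fun u => ?_, fun u => ?_, fun u => ?_⟩
  · exact HasDerivAt.fun_sum fun k _ =>
      (hasDerivAt_trace_line_pow S A (2 * k) u).div_const _
  · exact HasDerivAt.fun_sum fun k _ =>
      ((hasDerivAt_trace_mul_line_pow A S A (2 * k - 1) u).const_mul _).div_const _
  · have hH := isHermitian_line hS hA u
    set H := S + (u : ℂ) • A
    rcases N with _ | N
    · simp [coshTrace]
    -- The shift loses the top term of the truncated series; that term is nonnegative.
    have hmono : coshTrace N H ≤ coshTrace (N + 1) H := by
      unfold coshTrace
      rw [Finset.sum_range_succ]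
      exact le_add_of_nonneg_right (div_nonneg (trace_even_pow_nonneg hH N) (by positivity))
    refine le_trans ?_ (mul_le_mul_of_nonneg_left hmono (sq_nonneg Λ))
    beta_reduce
    rw [Finset.sum_range_succ', coshTrace, Finset.mul_sum _ _ (Λ ^ 2)]
    simp only [mul_zero, Nat.cast_zero, zero_mul, zero_div, add_zero]
    refine Finset.sum_le_sum fun k _ => ?_
    have hle : ∑ i ∈ Finset.range (2 * (k + 1) - 1),
        (A * (H ^ (2 * (k + 1) - 1 - 1 - i) * A * H ^ i)).trace.re
        ≤ ((2 * k + 1 : ℕ) : ℝ) * (Λ ^ 2 * (H ^ (2 * k)).trace.re) := by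
      rw [← nsmul_eq_mul]
      have hcard : (2 * k + 1 : ℕ) = (Finset.range (2 * (k + 1) - 1)).card := by
        rw [Finset.card_range]; omega
      rw [hcard]
      refine Finset.sum_le_card_nsmul _ _ _ fun i hi => ?_
      have hi' := Finset.mem_range.1 hi
      have := trace_mul_pow_mul_mul_pow_le hH hA hΛ
        (j := 2 * (k + 1) - 1 - 1 - i) (l := i) (k := k) (by omega)
      simpa only [mul_assoc] using this
    have hfac : ((2 * (k + 1)).factorial : ℝ)
        = ((2 * (k + 1) : ℕ) : ℝ) * (((2 * k + 1 : ℕ) : ℝ) * (2 * k).factorial) := by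
      rw [show 2 * (k + 1) = (2 * k + 1) + 1 by ring, Nat.factorial_succ, Nat.factorial_succ]
      push_cast; ring
    rw [hfac, mul_div_mul_left _ _ (by positivity), div_le_iff₀ (by positivity)]
    refine hle.trans (le_of_eq ?_)
    field_simp

end Trace

/-! ### A comparison principle -/

/-- The difference `h` of the two sides has `h'' ≥ Λ² h` and `h 0 = h' 0 = 0`. Factoring the
operator as `(d/du + Λ) (d/du - Λ)` reduces `h ≥ 0` to two first-order monotonicity arguments with
integrating factors `exp (± Λ u)`. -/
theorem le_exp_combination_of_deriv2_le {g g₁ g₂ : ℝ → ℝ} {Λ : ℝ} (hΛ : 0 < Λ)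
    (h1 : ∀ u, HasDerivAt g (g₁ u) u) (h2 : ∀ u, HasDerivAt g₁ (g₂ u) u)
    (hle : ∀ u, g₂ u ≤ Λ ^ 2 * g u) (u : ℝ) :
    g u ≤ (g 0 + g₁ 0 / Λ) / 2 * Real.exp (Λ * u) + (g 0 - g₁ 0 / Λ) / 2 * Real.exp (-(Λ * u)) := by
  set α := (g 0 + g₁ 0 / Λ) / 2
  set β := (g 0 - g₁ 0 / Λ) / 2
  have he : ∀ u, HasDerivAt (fun u : ℝ => Real.exp (Λ * u)) (Real.exp (Λ * u) * Λ) u := fun u => by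
    simpa using ((hasDerivAt_id u).const_mul Λ).exp
  have he' : ∀ u, HasDerivAt (fun u : ℝ => Real.exp (-(Λ * u))) (-(Real.exp (-(Λ * u)) * Λ)) u :=
    fun u => by simpa using ((hasDerivAt_id u).const_mul Λ).neg.exp
  set h : ℝ → ℝ := fun u => α * Real.exp (Λ * u) + β * Real.exp (-(Λ * u)) - g u with hh
  set k : ℝ → ℝ := fun u => α * (Real.exp (Λ * u) * Λ) + β * -(Real.exp (-(Λ * u)) * Λ) - g₁ u
    with hk
  have hd : ∀ u, HasDerivAt h (k u) u := fun u =>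
    (((he u).const_mul α).add ((he' u).const_mul β)).sub (h1 u)
  have kd : ∀ u, HasDerivAt k (Λ ^ 2 * (h u + g u) - g₂ u) u := fun u =>
    ((((((he u).mul_const Λ).const_mul α).add (((he' u).mul_const Λ).neg.const_mul β)).sub
      (h2 u))).congr_deriv (by simp only [hh]; ring)
  have h0 : h 0 = 0 := by
    simp only [hh, α, β, mul_zero, neg_zero, Real.exp_zero]; ring
  have k0 : k 0 = 0 := by
    simp only [hk, α, β, mul_zero, neg_zero, Real.exp_zero]
    field_simp
    ring
  -- This product vanishes at `0`, so `k - Λ h` has the sign of `u`; consequently `h * exp (-(Λ u))`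
  -- has its minimum, zero, at the origin.
  have hmono : Monotone fun u => (k u - Λ * h u) * Real.exp (Λ * u) := by
    refine monotone_of_hasDerivAt_nonneg (f' := fun u =>
      (Λ ^ 2 * g u - g₂ u) * Real.exp (Λ * u)) (fun u => ?_) fun u => ?_
    · exact (((kd u).sub ((hd u).const_mul Λ)).mul (he u)).congr_deriv (by
        simp only [Pi.sub_apply]; ring)
    · exact mul_nonneg (sub_nonneg.2 (hle u)) (Real.exp_pos _).le
  have hderiv : ∀ u, HasDerivAt (fun u => h u * Real.exp (-(Λ * u)))
      ((k u - Λ * h u) * Real.exp (-(Λ * u))) u := fun u =>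
    ((hd u).mul (he' u)).congr_deriv (by ring)
  have hcont : Continuous fun u => h u * Real.exp (-(Λ * u)) :=
    continuous_iff_continuousAt.2 fun u => (hderiv u).continuousAt
  suffices hs : 0 ≤ h u * Real.exp (-(Λ * u)) by
    have := nonneg_of_mul_nonneg_left hs (Real.exp_pos _)
    simp only [hh] at this
    linarith
  rcases le_total 0 u with hu | hu
  · have hm : MonotoneOn (fun u => h u * Real.exp (-(Λ * u))) (Set.Ici 0) := by
      refine monotoneOn_of_deriv_nonneg (convex_Ici 0) hcont.continuousOn
        (fun x _ => (hderiv x).differentiableAt.differentiableWithinAt) fun x hx => ?_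
      rw [interior_Ici] at hx
      rw [(hderiv x).deriv]
      have := hmono (le_of_lt hx)
      simp only [h0, k0, mul_zero, sub_zero, zero_mul] at this
      exact mul_nonneg (nonneg_of_mul_nonneg_left this (Real.exp_pos _)) (Real.exp_pos _).le
    have := hm Set.self_mem_Ici hu hu
    simpa [h0] using this
  · have hm : AntitoneOn (fun u => h u * Real.exp (-(Λ * u))) (Set.Iic 0) := by
      refine antitoneOn_of_deriv_nonpos (convex_Iic 0) hcont.continuousOn
        (fun x _ => (hderiv x).differentiableAt.differentiableWithinAt) fun x hx => ?_
      rw [interior_Iic] at hx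
      rw [(hderiv x).deriv]
      have := hmono (le_of_lt hx)
      simp only [h0, k0, mul_zero, sub_zero, zero_mul] at this
      refine mul_nonpos_of_nonpos_of_nonneg ?_ (Real.exp_pos _).le
      by_contra hc
      have := mul_pos (not_le.1 hc) (Real.exp_pos (Λ * x))
      linarith
    have := hm hu Set.self_mem_Iic hu
    simpa [h0] using this

/-- Divide by `exp (Λ u)` and let `u → ∞`. Nonnegative coefficients allow the two exponentials to be
averaged separately. -/
theorem nonneg_of_forall_nonneg_exp_combination {α β Λ : ℝ} (hΛ : 0 < Λ)
    (h : ∀ u : ℝ, 0 ≤ α * Real.exp (Λ * u) + β * Real.exp (-(Λ * u))) : 0 ≤ α := by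
  have hlim : Filter.Tendsto (fun u : ℝ => α + β * Real.exp (-(2 * Λ * u))) Filter.atTop
      (nhds (α + β * 0)) := by
    refine (Filter.Tendsto.const_mul β ?_).const_add α
    exact Real.tendsto_exp_neg_atTop_nhds_zero.comp
      (Filter.tendsto_id.const_mul_atTop (by positivity))
  rw [mul_zero, add_zero] at hlim
  refine ge_of_tendsto' hlim fun u => ?_
  have := mul_nonneg (h u) (Real.exp_pos (-(Λ * u))).le
  rw [add_mul, mul_assoc, mul_assoc, ← Real.exp_add, ← Real.exp_add] at this
  have e1 : Λ * u + -(Λ * u) = 0 := by ring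
  have e2 : -(Λ * u) + -(Λ * u) = -(2 * Λ * u) := by ring
  rwa [e1, e2, Real.exp_zero, mul_one] at this

/-- If `g'' ≤ Λ² g` and `g ≥ 0`, the average of `g` over a finite family of points of mean zero and
second moment `σ`, all within `1 / Λ` of the origin, is at most `g 0 * exp (Λ² σ)`. -/
theorem sum_weight_le_of_deriv2_le {β : Type*} {s : Finset β} {p U : β → ℝ}
    {g g₁ g₂ : ℝ → ℝ} {Λ : ℝ} (hΛ : 0 < Λ)
    (h1 : ∀ u, HasDerivAt g (g₁ u) u) (h2 : ∀ u, HasDerivAt g₁ (g₂ u) u)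
    (hle : ∀ u, g₂ u ≤ Λ ^ 2 * g u) (hg : ∀ u, 0 ≤ g u) (hp : ∀ x ∈ s, 0 ≤ p x)
    (hsum : ∑ x ∈ s, p x = 1) (hmean : ∑ x ∈ s, p x * U x = 0)
    (hU : ∀ x ∈ s, |Λ * U x| ≤ 1) :
    ∑ x ∈ s, p x * g (U x) ≤ g 0 * Real.exp (Λ ^ 2 * ∑ x ∈ s, p x * U x ^ 2) := by
  have hcmp := le_exp_combination_of_deriv2_le hΛ h1 h2 hle
  set α := (g 0 + g₁ 0 / Λ) / 2 with hα
  set β := (g 0 - g₁ 0 / Λ) / 2 with hβ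
  have hα0 : 0 ≤ α := nonneg_of_forall_nonneg_exp_combination hΛ (β := β)
    fun u => (hg u).trans (hcmp u)
  have hβ0 : 0 ≤ β := nonneg_of_forall_nonneg_exp_combination hΛ (β := α) fun u => by
    have := (hg (-u)).trans (hcmp (-u))
    rw [mul_neg, neg_neg] at this
    linarith
  have hexp : ∀ c : ℝ, |c| = Λ → ∑ x ∈ s, p x * Real.exp (c * U x)
      ≤ Real.exp (Λ ^ 2 * ∑ x ∈ s, p x * U x ^ 2) := by
    intro c hc
    have hc2 : c ^ 2 = Λ ^ 2 := by rw [← hc, sq_abs]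
    calc ∑ x ∈ s, p x * Real.exp (c * U x)
        ≤ ∑ x ∈ s, p x * (1 + c * U x + (c * U x) ^ 2) := by
          refine Finset.sum_le_sum fun x hx => mul_le_mul_of_nonneg_left ?_ (hp x hx)
          have hx1 : |c * U x| ≤ 1 := by
            rw [abs_mul, hc]
            have := hU x hx
            rwa [abs_mul, abs_of_pos hΛ] at this
          -- For `|x| ≤ 1`, `exp x ≤ 1 + x + x²`; the linear part then averages out.
          have := (abs_le.1 (Real.abs_exp_sub_one_sub_id_le hx1)).2
          linarith
      _ = Λ ^ 2 * ∑ x ∈ s, p x * U x ^ 2 + 1 := by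
          have : ∀ x, p x * (1 + c * U x + (c * U x) ^ 2)
              = p x + c * (p x * U x) + Λ ^ 2 * (p x * U x ^ 2) := fun x => by
            rw [mul_pow, hc2]; ring
          simp only [this, Finset.sum_add_distrib, ← Finset.mul_sum, hsum, hmean]
          ring
      _ ≤ _ := Real.add_one_le_exp _
  calc ∑ x ∈ s, p x * g (U x)
      ≤ ∑ x ∈ s, (α * (p x * Real.exp (Λ * U x)) + β * (p x * Real.exp (-Λ * U x))) := by
        refine Finset.sum_le_sum fun x hx => ?_
        have := mul_le_mul_of_nonneg_left (hcmp (U x)) (hp x hx)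
        rw [neg_mul]
        linarith
    _ ≤ α * Real.exp (Λ ^ 2 * ∑ x ∈ s, p x * U x ^ 2)
        + β * Real.exp (Λ ^ 2 * ∑ x ∈ s, p x * U x ^ 2) := by
        rw [Finset.sum_add_distrib, ← Finset.mul_sum, ← Finset.mul_sum]
        exact add_le_add
          (mul_le_mul_of_nonneg_left (hexp Λ (abs_of_pos hΛ)) hα0)
          (mul_le_mul_of_nonneg_left (hexp (-Λ) (by rw [abs_neg, abs_of_pos hΛ])) hβ0)
    _ = _ := by rw [hα, hβ]; ring

/-! ### Local terms as operators -/

/-- Used with exponent `2` to get `M² ≤ Λ²` from eigenvalue bounds, and with exponent `1` to bound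
energies by the largest `|eigenvalue|`. -/
theorem posSemidef_smul_one_add_smul_pow {ι : Type*} [Fintype ι] [DecidableEq ι]
    {H : Matrix ι ι ℂ} (hH : H.IsHermitian) (c d : ℝ) (k : ℕ)
    (h : ∀ a, 0 ≤ c + d * hH.eigenvalues a ^ k) :
    ((c : ℂ) • 1 + (d : ℂ) • H ^ k : Matrix ι ι ℂ).PosSemidef := by
  obtain ⟨U, -, h2, hp⟩ := exists_unitary_diagonalization hH
  have hdiag : (Matrix.diagonal fun a =>
      ((c + d * hH.eigenvalues a ^ k : ℝ) : ℂ)).PosSemidef :=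
    Matrix.PosSemidef.diagonal fun a => Complex.zero_le_real.2 (h a)
  have := hdiag.mul_mul_conjTranspose_same U
  convert this using 1
  have hsplit : (Matrix.diagonal fun a => ((c + d * hH.eigenvalues a ^ k : ℝ) : ℂ))
      = (c : ℂ) • 1 + (d : ℂ) • Matrix.diagonal (fun a => ((hH.eigenvalues a ^ k : ℝ) : ℂ)) := by
    ext a b
    by_cases hab : a = b
    · subst hab; simp
    · simp [hab]
  rw [hsplit, Matrix.mul_add, Matrix.add_mul, Matrix.mul_smul, Matrix.mul_smul, Matrix.smul_mul,
    Matrix.smul_mul, mul_one, h2, ← hp k]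

section Local

variable {n r : ℕ}

/-- A bit string is determined by its bits on the range of `T` and its other bits. -/
def splitEquiv (T : Fin r ↪ Fin n) :
    (Fin n → Fin 2) ≃ (Fin r → Fin 2) × ({q // q ∉ Set.range T} → Fin 2) :=
  Equiv.ofBijective (fun x => (fun j => x (T j), fun q => x q)) <| by
    classical
    refine ⟨fun x y hxy => ?_, fun ab => ?_⟩
    · rw [Prod.mk.injEq] at hxy
      funext q
      by_cases hq : q ∈ Set.range T
      · obtain ⟨j, rfl⟩ := hq
        exact congrFun hxy.1 j
      · exact congrFun hxy.2 ⟨q, hq⟩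
    · refine ⟨fun q => if hq : q ∈ Set.range T then ab.1 hq.choose else ab.2 ⟨q, hq⟩, ?_⟩
      refine Prod.ext (funext fun j => ?_) (funext fun q => ?_)
      · have hj : T j ∈ Set.range T := ⟨j, rfl⟩
        simp only [dif_pos hj]
        exact congrArg ab.1 (T.injective hj.choose_spec)
      · simp only [dif_neg q.2]

open scoped Kronecker in
open Classical in
-- Positivity and the bound on the square pass from the small matrix to the operator on all qubits
-- through this tensor form.
theorem LocalTerm.op_eq_kronecker (t : LocalTerm n r) :
    t.op = (t.mat ⊗ₖ (1 : Matrix ({q // q ∉ Set.range t.qubits} → Fin 2)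
      ({q // q ∉ Set.range t.qubits} → Fin 2) ℂ)).submatrix
        (splitEquiv t.qubits) (splitEquiv t.qubits) := by
  ext x y
  have hsplit : ∀ z, splitEquiv t.qubits z =
      ((fun j => z (t.qubits j)), fun q : {q // q ∉ Set.range t.qubits} => z q) :=
    fun _ => rfl
  simp only [LocalTerm.op, Matrix.of_apply, Matrix.submatrix_apply, Matrix.kroneckerMap_apply,
    Matrix.one_apply, hsplit, funext_iff, Subtype.forall, mul_ite, mul_one, mul_zero]

theorem LocalTerm.op_posSemidef (t : LocalTerm n r) : t.op.PosSemidef := by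
  classical
  rw [t.op_eq_kronecker]
  exact (t.posSemidef.kronecker Matrix.PosSemidef.one).submatrix _

open scoped Kronecker in
theorem LocalTerm.posSemidef_sq_sub_op_mul_op (t : LocalTerm n r) {Λ : ℝ}
    (hΛ : ∀ k, t.posSemidef.isHermitian.eigenvalues k ≤ Λ) :
    (((Λ ^ 2 : ℝ) : ℂ) • 1 - t.op * t.op).PosSemidef := by
  classical
  have h := posSemidef_smul_one_add_smul_pow t.posSemidef.isHermitian (Λ ^ 2) (-1) 2 fun a => by
    have := pow_le_pow_left₀ (t.posSemidef.eigenvalues_nonneg a) (hΛ a) 2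
    linarith
  have h2 := (h.kronecker (Matrix.PosSemidef.one (R := ℂ)
    (n := {q // q ∉ Set.range t.qubits} → Fin 2))).submatrix (splitEquiv t.qubits)
  rw [← Matrix.submatrix_one_equiv (splitEquiv t.qubits), t.op_eq_kronecker,
    Matrix.submatrix_mul_equiv, ← Matrix.mul_kronecker_mul, mul_one,
    ← Matrix.one_kronecker_one]
  refine (congrArg Matrix.PosSemidef ?_).mpr h2
  ext a b
  simp only [Matrix.sub_apply, Matrix.submatrix_apply, Matrix.kroneckerMap_apply,
    Matrix.add_apply, Matrix.smul_apply, sq, smul_eq_mul]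
  push_cast
  ring

end Local

/-! ### Energies -/

section Energy

variable {n : ℕ}

theorem energy_eq_re_dotProduct (A : Matrix (Fin n → Fin 2) (Fin n → Fin 2) ℂ) (ψ : Qubits n) :
    energy A ψ = (star ψ.ofLp ⬝ᵥ A *ᵥ ψ.ofLp).re := by
  rw [energy, EuclideanSpace.inner_eq_star_dotProduct, Matrix.ofLp_toEuclideanCLM,
    dotProduct_comm]

theorem energy_add (A B : Matrix (Fin n → Fin 2) (Fin n → Fin 2) ℂ) (ψ : Qubits n) :
    energy (A + B) ψ = energy A ψ + energy B ψ := by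
  simp [energy, map_add]

theorem energy_smul (c : ℝ) (A : Matrix (Fin n → Fin 2) (Fin n → Fin 2) ℂ) (ψ : Qubits n) :
    energy ((c : ℂ) • A) ψ = c * energy A ψ := by
  rw [energy_eq_re_dotProduct, energy_eq_re_dotProduct, Matrix.smul_mulVec, dotProduct_smul,
    smul_eq_mul, Complex.re_ofReal_mul]

theorem energy_sub (A B : Matrix (Fin n → Fin 2) (Fin n → Fin 2) ℂ) (ψ : Qubits n) :
    energy (A - B) ψ = energy A ψ - energy B ψ := by
  simp [energy, map_sub]

theorem energy_one {ψ : Qubits n} (hψ : ‖ψ‖ = 1) :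
    energy (1 : Matrix (Fin n → Fin 2) (Fin n → Fin 2) ℂ) ψ = 1 := by
  simp [energy, hψ]

theorem energy_nonneg {A : Matrix (Fin n → Fin 2) (Fin n → Fin 2) ℂ} (hA : A.PosSemidef)
    (ψ : Qubits n) : 0 ≤ energy A ψ := by
  rw [energy_eq_re_dotProduct]
  exact hA.re_dotProduct_nonneg _

theorem energy_le_opt (A : Matrix (Fin n → Fin 2) (Fin n → Fin 2) ℂ) {ψ : Qubits n}
    (hψ : ‖ψ‖ = 1) : energy A ψ ≤ opt A :=
  (isGreatest_opt A).2 ⟨ψ, hψ, rfl⟩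

theorem exists_energy_eq_opt (A : Matrix (Fin n → Fin 2) (Fin n → Fin 2) ℂ) :
    ∃ ψ : Qubits n, ‖ψ‖ = 1 ∧ energy A ψ = opt A :=
  (isGreatest_opt A).1

theorem opt_nonneg {A : Matrix (Fin n → Fin 2) (Fin n → Fin 2) ℂ} (hA : A.PosSemidef) :
    0 ≤ opt A := by
  obtain ⟨ψ, -, h⟩ := exists_energy_eq_opt A
  exact h ▸ energy_nonneg hA ψ

theorem exists_le_abs_eigenvalue {H : Matrix (Fin n → Fin 2) (Fin n → Fin 2) ℂ}
    (hH : H.IsHermitian) {ψ : Qubits n} (hψ : ‖ψ‖ = 1) :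
    ∃ a, |energy H ψ| ≤ |hH.eigenvalues a| := by
  obtain ⟨a, -, ha⟩ := Finset.exists_max_image Finset.univ (fun a => |hH.eigenvalues a|)
    ⟨fun _ => 0, Finset.mem_univ _⟩
  refine ⟨a, ?_⟩
  have key : ∀ d : ℝ, |d| = 1 → 0 ≤ |hH.eigenvalues a| + d * energy H ψ := fun d hd => by
    have := energy_nonneg (posSemidef_smul_one_add_smul_pow hH |hH.eigenvalues a| d 1 fun b => by
      have h1 := neg_abs_le (d * hH.eigenvalues b)
      rw [abs_mul, hd, one_mul] at h1
      have h2 := ha b (Finset.mem_univ b)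
      rw [pow_one]
      linarith) ψ
    rwa [energy_add, energy_smul, energy_smul, energy_one hψ, pow_one, mul_one] at this
  have h1 := key 1 (by simp)
  have h2 := key (-1) (by simp)
  rw [abs_le]
  constructor <;> linarith

/-- A single eigenvalue of modulus at least `t` already contributes the left side, as even powers of
the others are nonnegative. -/
theorem le_coshTrace {H : Matrix (Fin n → Fin 2) (Fin n → Fin 2) ℂ} (hH : H.IsHermitian)
    {ψ : Qubits n} (hψ : ‖ψ‖ = 1) {t : ℝ} (ht : 0 ≤ t) (h : t ≤ |energy H ψ|) (N : ℕ) :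
    ∑ k ∈ Finset.range N, t ^ (2 * k) / (2 * k).factorial ≤ coshTrace N H := by
  obtain ⟨a, ha⟩ := exists_le_abs_eigenvalue hH hψ
  refine Finset.sum_le_sum fun k _ => div_le_div_of_nonneg_right ?_ (by positivity)
  rw [trace_pow_eq_sum_eigenvalues hH]
  calc t ^ (2 * k) ≤ |hH.eigenvalues a| ^ (2 * k) := pow_le_pow_left₀ ht (h.trans ha) _
    _ = hH.eigenvalues a ^ (2 * k) := by rw [pow_mul, pow_mul, sq_abs]
    _ ≤ _ := Finset.single_le_sum (f := fun a => hH.eigenvalues a ^ (2 * k))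
        (fun b _ => by rw [pow_mul]; positivity) (Finset.mem_univ a)

end Energy

/-! ### Concentration of random sums of matrices -/

/-- The starting matrix `S` is arbitrary so that induction can absorb the first random term into it;
averaging over that term costs one factor `exp (Λ² σ)`. -/
theorem sum_prod_mul_coshTrace_le {ι β : Type*} [Fintype ι] [DecidableEq ι] [Fintype β]
    {p U : β → ℝ} {Λ : ℝ} (hΛ : 0 < Λ) (hp : ∀ x, 0 ≤ p x) (hsum : ∑ x, p x = 1)
    (hmean : ∑ x, p x * U x = 0) (hU : ∀ x, |Λ * U x| ≤ 1) (N m : ℕ)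
    (A : Fin m → Matrix ι ι ℂ) (hA : ∀ i, (A i).IsHermitian)
    (hAΛ : ∀ i, (((Λ ^ 2 : ℝ) : ℂ) • 1 - A i * A i).PosSemidef)
    {S : Matrix ι ι ℂ} (hS : S.IsHermitian) :
    ∑ f : Fin m → β, (∏ i, p (f i)) * coshTrace N (S + ∑ i, (U (f i) : ℂ) • A i)
      ≤ coshTrace N S * Real.exp (Λ ^ 2 * ∑ x, p x * U x ^ 2) ^ m := by
  induction m generalizing S with
  | zero => simp
  | succ m ih =>
    rw [← (Fin.consEquiv fun _ => β).sum_comp, Fintype.sum_prod_type]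
    set E := Real.exp (Λ ^ 2 * ∑ x, p x * U x ^ 2) with hE
    obtain ⟨g₁, g₂, h1, h2, h3⟩ := coshTrace_line_derivs hS (hA 0) (hAΛ 0) N
    calc ∑ x, ∑ f : Fin m → β, (∏ i, p ((Fin.consEquiv fun _ => β) (x, f) i)) *
          coshTrace N (S + ∑ i, (U ((Fin.consEquiv fun _ => β) (x, f) i) : ℂ) • A i)
        = ∑ x, p x * ∑ f : Fin m → β, (∏ i, p (f i)) *
          coshTrace N ((S + (U x : ℂ) • A 0) + ∑ i, (U (f i) : ℂ) • A i.succ) := by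
          refine Finset.sum_congr rfl fun x _ => ?_
          rw [Finset.mul_sum]
          refine Finset.sum_congr rfl fun f _ => ?_
          rw [Fin.prod_univ_succ, Fin.sum_univ_succ]
          simp [Fin.consEquiv, mul_assoc, add_assoc]
      _ ≤ ∑ x, p x * (coshTrace N (S + (U x : ℂ) • A 0) * E ^ m) :=
          Finset.sum_le_sum fun x _ => mul_le_mul_of_nonneg_left
            (ih _ (fun i => hA i.succ) (fun i => hAΛ i.succ) (isHermitian_line hS (hA 0) _)) (hp x)
      _ = (∑ x, p x * coshTrace N (S + (U x : ℂ) • A 0)) * E ^ m := by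
          rw [Finset.sum_mul]; exact Finset.sum_congr rfl fun x _ => by ring
      _ ≤ (coshTrace N S * E) * E ^ m := by
          refine mul_le_mul_of_nonneg_right ?_ (by positivity)
          have := sum_weight_le_of_deriv2_le hΛ h1 h2 h3
            (fun u => coshTrace_nonneg N (isHermitian_line hS (hA 0) u)) (fun x _ => hp x) hsum
            hmean (fun x _ => hU x)
          simpa using this
      _ = _ := by ring

open Classical in
/-- Matrix Chernoff bound for sampling every term independently with probability `p`. -/
theorem card_large_deviation_le {n m : ℕ} {β : Type*} [Fintype β] [Nonempty β] (I : β → Prop) {p Λ θ t : ℝ}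
    (hΛ : 0 < Λ) (hp0 : 0 < p) (hp1 : p ≤ 1)
    (hpI : ((Finset.univ.filter I).card : ℝ) = p * Fintype.card β)
    (hθ : 0 < θ) (hθp : θ * Λ ≤ p) (ht : 0 ≤ t)
    (A : Fin m → Matrix (Fin n → Fin 2) (Fin n → Fin 2) ℂ) (hA : ∀ i, (A i).IsHermitian)
    (hAΛ : ∀ i, (((Λ ^ 2 : ℝ) : ℂ) • 1 - A i * A i).PosSemidef) :
    ((Finset.univ.filter fun f : Fin m → β => ∃ ψ : Qubits n, ‖ψ‖ = 1 ∧
      t ≤ |energy (∑ i, (((if I (f i) then 1 / p else 0) - 1 : ℝ) : ℂ) • A i) ψ|).card : ℝ)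
      ≤ (Fintype.card β : ℝ) ^ m *
        (2 * 2 ^ n * Real.exp (m * (θ ^ 2 * Λ ^ 2 / p) - θ * t)) := by
  set b : ℝ := (Fintype.card β : ℝ) with hb
  have hb0 : 0 < b := Nat.cast_pos.2 Fintype.card_pos
  set V : β → ℝ := fun x => (if I x then 1 / p else 0) - 1 with hV
  set D : (Fin m → β) → Matrix (Fin n → Fin 2) (Fin n → Fin 2) ℂ :=
    fun f => ∑ i, (V (f i) : ℂ) • A i with hD
  have hDherm : ∀ f, (D f).IsHermitian := fun f => by
    rw [hD]
    refine isSelfAdjoint_sum _ fun i _ => ?_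
    have := isHermitian_line Matrix.isHermitian_zero (hA i) (V (f i))
    rwa [zero_add] at this
  have hDθ : ∀ f, ((θ : ℂ) • D f).IsHermitian := fun f => by
    simpa using isHermitian_line Matrix.isHermitian_zero (hDherm f) θ
  have hVsum : ∀ x y : ℝ, ∑ z, (if I z then x else y) = p * b * x + (b - p * b) * y := by
    intro x y
    have hnot : ((Finset.univ.filter fun z => ¬ I z).card : ℝ) = b - p * b := by
      rw [← hpI, eq_sub_iff_add_eq', ← Nat.cast_add, Finset.card_filter_add_card_filter_not,
        Finset.card_univ]
    rw [Finset.sum_ite, Finset.sum_const, Finset.sum_const, nsmul_eq_mul, nsmul_eq_mul, hpI, hnot]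
  have hVcases : ∀ F : ℝ → ℝ, ∀ x, F (V x) = if I x then F (1 / p - 1) else F (-1) := by
    intro F x
    simp only [hV]
    split_ifs <;> simp
  have hmean : ∑ x, b⁻¹ * (θ * V x) = 0 := by
    simp only [hVcases fun v => b⁻¹ * (θ * v), hVsum]
    field_simp
    ring
  have hvar : ∑ x, b⁻¹ * (θ * V x) ^ 2 ≤ θ ^ 2 / p := by
    simp only [hVcases fun v => b⁻¹ * (θ * v) ^ 2, hVsum]
    have : p * b * (b⁻¹ * (θ * (1 / p - 1)) ^ 2) + (b - p * b) * (b⁻¹ * (θ * -1) ^ 2)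
        = θ ^ 2 / p - θ ^ 2 := by
      field_simp
      ring
    rw [this]
    linarith [sq_nonneg θ]
  -- Here `θ Λ ≤ p` is used: weights can be as large as `1 / p`, and the quadratic bound on `exp`
  -- needs arguments of modulus at most `1`.
  have hVbound : ∀ x, |Λ * (θ * V x)| ≤ 1 := by
    intro x
    have h1 : |V x| ≤ 1 / p := by
      have h1p : 1 ≤ 1 / p := by rwa [le_div_iff₀ hp0, one_mul]
      rw [hVcases fun v => |v|]
      split_ifs
      · rw [abs_of_nonneg (by linarith)]; linarith
      · simpa using h1p
    rw [← mul_assoc, abs_mul, abs_of_pos (by positivity), mul_comm Λ θ]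
    calc θ * Λ * |V x| ≤ p * (1 / p) := mul_le_mul hθp h1 (abs_nonneg _) hp0.le
      _ = 1 := by field_simp
  set B := Finset.univ.filter fun f : Fin m → β => ∃ ψ : Qubits n, ‖ψ‖ = 1 ∧ t ≤ |energy (D f) ψ|
    with hB
  set R : ℝ := 2 ^ n * Real.exp (m * (θ ^ 2 * Λ ^ 2 / p)) with hR
  have hN : ∀ N, (B.card : ℝ) * (b⁻¹ ^ m * ∑ k ∈ Finset.range N,
      (θ * t) ^ (2 * k) / (2 * k).factorial) ≤ R := by
    intro N
    have h := sum_prod_mul_coshTrace_le hΛ (fun _ => (inv_pos.2 hb0).le)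
      (by rw [Finset.sum_const, Finset.card_univ, nsmul_eq_mul]; exact mul_inv_cancel₀ hb0.ne')
      hmean hVbound N m A hA hAΛ Matrix.isHermitian_zero
    have hsum : ∀ f : Fin m → β, (0 : Matrix (Fin n → Fin 2) (Fin n → Fin 2) ℂ)
        + ∑ i, ((θ * V (f i) : ℝ) : ℂ) • A i = (θ : ℂ) • D f := fun f => by
      rw [zero_add, hD, Finset.smul_sum]
      exact Finset.sum_congr rfl fun i _ => by rw [smul_smul, Complex.ofReal_mul]
    simp only [hsum, Finset.prod_const, Finset.card_univ, Fintype.card_fin] at h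
    rw [← nsmul_eq_mul]
    calc _ ≤ ∑ f ∈ B, b⁻¹ ^ m * coshTrace N ((θ : ℂ) • D f) := by
          refine Finset.card_nsmul_le_sum _ _ _ fun f hf => ?_
          obtain ⟨ψ, hψ, hle⟩ := (Finset.mem_filter.1 hf).2
          refine mul_le_mul_of_nonneg_left ?_ (by positivity)
          refine le_coshTrace (hDθ f) hψ (by positivity) ?_ N
          rw [energy_smul, abs_mul, abs_of_pos hθ]
          exact mul_le_mul_of_nonneg_left hle hθ.le
      _ ≤ ∑ f, b⁻¹ ^ m * coshTrace N ((θ : ℂ) • D f) :=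
          Finset.sum_le_sum_of_subset_of_nonneg (Finset.subset_univ _) fun f _ _ =>
            mul_nonneg (by positivity) (coshTrace_nonneg N (hDθ f))
      _ ≤ _ := h
      _ ≤ R := by
          rw [← Real.exp_nat_mul, hR]
          refine mul_le_mul ?_ (Real.exp_le_exp.2 ?_) (Real.exp_pos _).le (by positivity)
          · simpa using coshTrace_zero_le (ι := Fin n → Fin 2) N
          · refine mul_le_mul_of_nonneg_left ?_ (Nat.cast_nonneg m)
            calc _ ≤ Λ ^ 2 * (θ ^ 2 / p) := mul_le_mul_of_nonneg_left hvar (sq_nonneg Λ)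
              _ = _ := by ring
  -- The bound `R` does not depend on the truncation, so the Taylor sums may be replaced by `cosh`.
  have hlim : (B.card : ℝ) * (b⁻¹ ^ m * Real.cosh (θ * t)) ≤ R :=
    le_of_tendsto' (((Real.hasSum_cosh (θ * t)).tendsto_sum_nat.const_mul _).const_mul _) hN
  have hcosh : Real.exp (θ * t) / 2 ≤ Real.cosh (θ * t) := by
    rw [Real.cosh_eq]
    linarith [Real.exp_pos (-(θ * t))]
  have hfin : (B.card : ℝ) * (b⁻¹ ^ m * (Real.exp (θ * t) / 2)) ≤ R :=
    le_trans (by gcongr) hlim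
  rw [Real.exp_sub]
  have he := Real.exp_pos (θ * t)
  calc (B.card : ℝ) = (B.card : ℝ) * (b⁻¹ ^ m * (Real.exp (θ * t) / 2))
        * (b ^ m * 2 / Real.exp (θ * t)) := by rw [inv_pow]; field_simp
    _ ≤ R * (b ^ m * 2 / Real.exp (θ * t)) := by gcongr
    _ = _ := by rw [hR]; ring

/-! ### Sampled instances are sparsifiers -/

section Sparsifier

variable {n r m : ℕ}

theorem weightedHam_support (H : Instance n r m) (w : Fin m → ℝ) :
    weightedHam H {i | w i ≠ 0} w = ∑ i, (w i : ℂ) • (H i).op := by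
  refine Finset.sum_subset (Finset.subset_univ _) fun i _ hi => ?_
  have : w i = 0 := by simpa using hi
  simp [this]

theorem ham_posSemidef (H : Instance n r m) : (ham H).PosSemidef :=
  Matrix.posSemidef_sum _ fun i _ => (H i).op_posSemidef

theorem isSparsifier_zero (H : Instance n r m) {C ε : ℝ} (hC : 0 ≤ C) (hε : 1 / 2 ≤ ε)
    {w : Fin m → ℝ} (hw : ∀ i, w i = 0) :
    IsSparsifier H C ε ({i | w i ≠ 0} : Finset (Fin m)) w := by
  obtain rfl : w = fun _ => 0 := funext hw
  refine ⟨fun _ _ => le_rfl, ?_, fun ψ _ _ => ?_⟩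
  · simp only [ne_eq, not_true_eq_false, Finset.filter_false, Finset.card_empty, Nat.cast_zero]
    positivity
  · exact (mul_nonpos_of_nonpos_of_nonneg (by linarith) (opt_nonneg (ham_posSemidef H))).trans
      (energy_nonneg (ham_posSemidef H) ψ)

theorem isSparsifier_of_abs_energy_le {H : Instance n r m} {C c ε : ℝ} {w : Fin m → ℝ}
    (hε0 : 0 < ε) (hε1 : ε ≤ 1) (hopt : c * m ≤ opt (ham H)) (hw : ∀ i, 0 ≤ w i)
    (hcard : (({i | w i ≠ 0} : Finset (Fin m)).card : ℝ) ≤ C * n / ε ^ 2)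
    (h : ∀ ψ : Qubits n, ‖ψ‖ = 1 →
      |energy (∑ i, ((w i - 1 : ℝ) : ℂ) • (H i).op) ψ| ≤ ε * c * m / 2) :
    IsSparsifier H C ε ({i | w i ≠ 0} : Finset (Fin m)) w := by
  refine ⟨fun i _ => hw i, hcard, fun ψ hψ hle => ?_⟩
  rw [weightedHam_support] at hle
  set W : Matrix (Fin n → Fin 2) (Fin n → Fin 2) ℂ := ∑ i, (w i : ℂ) • (H i).op
  have hdiff : ∑ i, ((w i - 1 : ℝ) : ℂ) • (H i).op = W - ham H := by
    rw [ham, ← Finset.sum_sub_distrib]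
    refine Finset.sum_congr rfl fun i _ => ?_
    rw [Complex.ofReal_sub, Complex.ofReal_one, sub_smul, one_smul]
  simp only [hdiff, energy_sub] at h
  obtain ⟨φ, hφ, hφopt⟩ := exists_energy_eq_opt (ham H)
  have h1 := (abs_le.1 (h ψ hψ)).2
  have h2 := (abs_le.1 (h φ hφ)).1
  have h3 := energy_le_opt W hφ
  have h4 := opt_nonneg (ham_posSemidef H)
  rw [hφopt] at h2
  -- The hypothesis `OPT ≥ c m` turns the additive error into a relative one.
  have h5 : ε * c * m / 2 ≤ ε / 2 * opt (ham H) := by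
    have := mul_le_mul_of_nonneg_left hopt (by positivity : (0 : ℝ) ≤ ε / 2)
    linarith
  have h6 : (1 - ε) * ((1 - ε / 2) * opt (ham H)) ≤ (1 - ε) * opt W :=
    mul_le_mul_of_nonneg_left (by linarith) (by linarith)
  have h7 : (0 : ℝ) ≤ ε ^ 2 / 2 * opt (ham H) := by positivity
  linarith

theorem isSparsifier_one {H : Instance n r m} {C c ε : ℝ} (hc : 0 ≤ c)
    (hε0 : 0 < ε) (hε1 : ε ≤ 1) (hopt : c * m ≤ opt (ham H)) (hcard : (m : ℝ) ≤ C * n / ε ^ 2)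
    {w : Fin m → ℝ} (hw : ∀ i, w i = 1) :
    IsSparsifier H C ε ({i | w i ≠ 0} : Finset (Fin m)) w := by
  obtain rfl : w = fun _ => 1 := funext hw
  refine isSparsifier_of_abs_energy_le hε0 hε1 hopt (fun _ => zero_le_one) ?_ fun ψ _ => ?_
  · simpa using hcard
  · simp only [sub_self, Complex.ofReal_zero, zero_smul, Finset.sum_const_zero]
    simp only [energy, map_zero, zero_apply, inner_zero_right, Complex.zero_re,
      abs_zero]
    positivity

/-- The weights of the sample in which term `i` survives iff all its `k` coins come up heads. -/
def sampleWeights {k : ℕ} (x : Fin m → Fin k → Bool) (i : Fin m) : ℝ :=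
  if ∀ l, x i l = true then 2 ^ k else 0

theorem card_allHeads (k : ℕ) {d : DecidablePred fun y : Fin k → Bool => ∀ l, y l = true} :
    (Finset.univ.filter fun y : Fin k → Bool => ∀ l, y l = true).card = 1 := by
  rw [Finset.card_eq_one]
  refine ⟨fun _ => true, ?_⟩
  ext y
  simp [funext_iff]

/-- Exponential Markov: the mean of `exp |L|` is `(1 + (e - 1) / 2ᵏ) ^ m ≤ exp (2 m / 2ᵏ) ≤ exp (2
τ)`, compared with `exp (4 τ)`. -/
theorem card_support_sampleWeights_large_le {k : ℕ} {τ : ℝ} (hτ : (m : ℝ) / 2 ^ k ≤ τ) :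
    ((Finset.univ.filter fun x : Fin m → Fin k → Bool =>
      4 * τ < (({i | sampleWeights x i ≠ 0} : Finset (Fin m)).card : ℝ)).card : ℝ)
      ≤ (2 ^ k) ^ m * Real.exp (-(2 * τ)) := by
  set B := Finset.univ.filter fun x : Fin m → Fin k → Bool =>
      4 * τ < (({i | sampleWeights x i ≠ 0} : Finset (Fin m)).card : ℝ) with hB
  have hprod : ∀ x : Fin m → Fin k → Bool,
      Real.exp (({i | sampleWeights x i ≠ 0} : Finset (Fin m)).card : ℝ)
        = ∏ i, (if ∀ l, x i l = true then Real.exp 1 else 1) := fun x => by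
    rw [Finset.prod_ite, Finset.prod_const, Finset.prod_const_one, mul_one, ← Real.exp_nat_mul,
      mul_one]
    congr 3
    ext i
    simp [sampleWeights]
  have hsum : ∑ y : Fin k → Bool, (if ∀ l, y l = true then Real.exp 1 else 1)
      = 2 ^ k + (Real.exp 1 - 1) := by
    have : ∀ y : Fin k → Bool, (if ∀ l, y l = true then Real.exp 1 else 1)
        = 1 + (if ∀ l, y l = true then Real.exp 1 - 1 else 0) := fun y => by
      split_ifs <;> ring
    simp only [this, Finset.sum_add_distrib]
    rw [← Finset.sum_filter, Finset.sum_const, Finset.sum_const, card_allHeads]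
    simp
  have hle : (B.card : ℝ) * Real.exp (4 * τ) ≤ (2 ^ k + (Real.exp 1 - 1)) ^ m := by
    rw [← hsum, Fintype.sum_pow, ← nsmul_eq_mul]
    calc _ ≤ ∑ x ∈ B, ∏ i, (if ∀ l, x i l = true then Real.exp 1 else 1) := by
          refine Finset.card_nsmul_le_sum _ _ _ fun x hx => ?_
          rw [← hprod]
          exact Real.exp_le_exp.2 (Finset.mem_filter.1 hx).2.le
      _ ≤ _ := Finset.sum_le_sum_of_subset_of_nonneg (Finset.subset_univ _) fun x _ _ => by
          rw [← hprod]; exact (Real.exp_pos _).le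
  have hpow : (2 ^ k + (Real.exp 1 - 1)) ^ m ≤ (2 ^ k) ^ m * Real.exp (2 * τ) := by
    have he : Real.exp 1 - 1 ≤ 2 := by linarith [Real.exp_one_lt_d9]
    have h1 : (2 : ℝ) ^ k + (Real.exp 1 - 1) ≤ 2 ^ k * Real.exp (2 / 2 ^ k) := by
      have := Real.add_one_le_exp ((2 : ℝ) / 2 ^ k)
      calc (2 : ℝ) ^ k + (Real.exp 1 - 1) ≤ 2 ^ k + 2 := by linarith
        _ = 2 ^ k * (2 / 2 ^ k + 1) := by field_simp; ring
        _ ≤ _ := by gcongr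
    calc _ ≤ (2 ^ k * Real.exp (2 / 2 ^ k)) ^ m := by
          refine pow_le_pow_left₀ ?_ h1 m
          have := Real.add_one_le_exp (1 : ℝ)
          have : (0 : ℝ) < 2 ^ k := by positivity
          linarith
      _ = (2 ^ k) ^ m * Real.exp (m * (2 / 2 ^ k)) := by rw [mul_pow, ← Real.exp_nat_mul]
      _ ≤ _ := by
          refine mul_le_mul_of_nonneg_left (Real.exp_le_exp.2 ?_) (by positivity)
          calc (m : ℝ) * (2 / 2 ^ k) = 2 * (m / 2 ^ k) := by ring
            _ ≤ 2 * τ := by gcongr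
  have hsplit : Real.exp (-(2 * τ)) * Real.exp (4 * τ) = Real.exp (2 * τ) := by
    rw [← Real.exp_add]; ring_nf
  refine le_of_mul_le_mul_right ?_ (Real.exp_pos (4 * τ))
  rw [mul_assoc, hsplit]
  exact hle.trans hpow

open Classical in
theorem card_large_energy_le {H : Instance n r m} {Λ c ε : ℝ} (k : ℕ) (hc : 0 < c) (hcΛ : c ≤ Λ)
    (hΛ : EigenvaluesLE H Λ) (hε0 : 0 < ε) (hε1 : ε ≤ 1) :
    ((Finset.univ.filter fun x : Fin m → Fin k → Bool => ∃ ψ : Qubits n, ‖ψ‖ = 1 ∧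
      ε * c * m / 2 ≤ |energy (∑ i, ((sampleWeights x i - 1 : ℝ) : ℂ) • (H i).op) ψ|).card : ℝ)
      ≤ (2 ^ k) ^ m * (2 * 2 ^ n * Real.exp (-(m / 2 ^ k * (ε ^ 2 * c ^ 2 / (16 * Λ ^ 2))))) := by
  have hΛ0 : 0 < Λ := hc.trans_le hcΛ
  have h := card_large_deviation_le (n := n) (m := m) (β := Fin k → Bool)
    -- This `θ` minimises the exponent `m θ² Λ² / p - θ t` at `p = 2⁻ᵏ`, `t = ε c m / 2`.
    (fun y => ∀ l, y l = true) (p := 1 / 2 ^ k) (Λ := Λ) (θ := 1 / 2 ^ k * ε * c / (4 * Λ ^ 2))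
    (t := ε * c * m / 2) hΛ0 (by positivity)
    ((div_le_one (by positivity)).2 (one_le_pow₀ one_le_two))
    (by rw [card_allHeads]; simp) (by positivity)
    (by
      rw [div_mul_eq_mul_div, div_le_iff₀ (by positivity), mul_assoc (1 / 2 ^ k), mul_assoc]
      refine mul_le_mul_of_nonneg_left ?_ (by positivity)
      have : ε * c ≤ 1 * Λ := mul_le_mul hε1 hcΛ hc.le zero_le_one
      nlinarith)
    (by positivity) (fun i => (H i).op) (fun i => (H i).op_posSemidef.isHermitian)
    (fun i => (H i).posSemidef_sq_sub_op_mul_op (hΛ i))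
  have hexp : (m : ℝ) * ((1 / 2 ^ k * ε * c / (4 * Λ ^ 2)) ^ 2 * Λ ^ 2 / (1 / 2 ^ k))
      - 1 / 2 ^ k * ε * c / (4 * Λ ^ 2) * (ε * c * m / 2)
      = -(m / 2 ^ k * (ε ^ 2 * c ^ 2 / (16 * Λ ^ 2))) := by
    field_simp
    ring
  rw [hexp] at h
  simpa [sampleWeights] using h

open Classical in
/-- With probability at least `1 - 2⁻ⁿ`, the random sample is a sparsifier. -/
theorem card_not_isSparsifier_le {H : Instance n r m} {Λ c ε C : ℝ} {k : ℕ} (hn : 0 < n)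
    (hc : 0 < c) (hcΛ : c ≤ Λ) (hΛ : EigenvaluesLE H Λ) (hε0 : 0 < ε) (hε1 : ε ≤ 1)
    (hopt : c * m ≤ opt (ham H)) (hC1 : 1 ≤ C) (hC : 128 * Λ ^ 2 / c ^ 2 ≤ C)
    (hk1 : (m : ℝ) / 2 ^ k ≤ C * n / ε ^ 2) (hk2 : C * n / ε ^ 2 / 2 ≤ m / 2 ^ k) :
    ((Finset.univ.filter fun x : Fin m → Fin k → Bool =>
      ¬ IsSparsifier H (4 * C) ε ({i | sampleWeights x i ≠ 0} : Finset (Fin m))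
        (sampleWeights x)).card : ℝ) ≤ (2 ^ k) ^ m / 2 ^ n := by
  have hΛ0 : 0 < Λ := hc.trans_le hcΛ
  have hn1 : (1 : ℝ) ≤ n := by exact_mod_cast hn
  have h1 := card_support_sampleWeights_large_le hk1
  have h2 := card_large_energy_le k hc hcΛ hΛ hε0 hε1
  set B := Finset.univ.filter fun x : Fin m → Fin k → Bool =>
      ¬ IsSparsifier H (4 * C) ε ({i | sampleWeights x i ≠ 0} : Finset (Fin m)) (sampleWeights x)
  set B1 := Finset.univ.filter fun x : Fin m → Fin k → Bool =>
      4 * (C * n / ε ^ 2) < (({i | sampleWeights x i ≠ 0} : Finset (Fin m)).card : ℝ)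
  set B2 := Finset.univ.filter fun x : Fin m → Fin k → Bool => ∃ ψ : Qubits n, ‖ψ‖ = 1 ∧
      ε * c * m / 2 ≤ |energy (∑ i, ((sampleWeights x i - 1 : ℝ) : ℂ) • (H i).op) ψ|
  have hsub : B ⊆ B1 ∪ B2 := by
    intro x hx
    by_contra hnot
    rw [Finset.mem_union, not_or, Finset.mem_filter, Finset.mem_filter] at hnot
    simp only [Finset.mem_univ, true_and, not_lt, not_exists, not_and, not_le] at hnot
    refine (Finset.mem_filter.1 hx).2 (isSparsifier_of_abs_energy_le hε0 hε1 hopt (fun i => ?_)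
      (hnot.1.trans_eq (by ring)) fun ψ hψ => (hnot.2 ψ hψ).le)
    rw [sampleWeights]
    split_ifs <;> positivity
  have hcard : (B.card : ℝ) ≤ B1.card + B2.card := by
    exact_mod_cast (Finset.card_le_card hsub).trans (Finset.card_union_le _ _)
  have hτ : (n : ℝ) ≤ C * n / ε ^ 2 := by
    rw [le_div_iff₀ (by positivity)]
    have : ε ^ 2 ≤ 1 := pow_le_one₀ hε0.le hε1
    nlinarith
  have he : (2 : ℝ) ≤ Real.exp 1 := by linarith [Real.add_one_le_exp (1 : ℝ)]
  have hpow : ∀ j : ℕ, Real.exp (-(j : ℝ)) ≤ 1 / 2 ^ j := fun j => by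
    rw [Real.exp_neg, ← one_div, ← mul_one (j : ℝ), Real.exp_nat_mul]
    exact one_div_le_one_div_of_le (by positivity) (pow_le_pow_left₀ zero_le_two he j)
  have e1 : Real.exp (-(2 * (C * n / ε ^ 2))) ≤ 1 / 2 ^ n / 2 := by
    calc _ ≤ Real.exp (-((n + 1 : ℕ) : ℝ)) := Real.exp_le_exp.2 (by push_cast; linarith)
      _ ≤ _ := hpow _
      _ = _ := by rw [pow_succ]; field_simp
  have e2 : 2 * 2 ^ n * Real.exp (-(m / 2 ^ k * (ε ^ 2 * c ^ 2 / (16 * Λ ^ 2))))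
      ≤ 1 / 2 ^ n / 2 := by
    -- The constant `128 = 4 * 32` makes the exponent at least `4 n ≥ 2 n + 2`, enough to beat the
    -- dimension factor `2 * 2ⁿ` and leave half of the failure probability `2⁻ⁿ`.
    have hx : ((n + n + 2 : ℕ) : ℝ) ≤ m / 2 ^ k * (ε ^ 2 * c ^ 2 / (16 * Λ ^ 2)) := by
      have h128 : 128 * Λ ^ 2 ≤ C * c ^ 2 := by rwa [div_le_iff₀ (by positivity)] at hC
      calc ((n + n + 2 : ℕ) : ℝ) ≤ 4 * n := by push_cast; linarith
        _ = 128 * Λ ^ 2 * (n / (32 * Λ ^ 2)) := by field_simp; norm_num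
        _ ≤ C * c ^ 2 * (n / (32 * Λ ^ 2)) := by gcongr
        _ = C * n / ε ^ 2 / 2 * (ε ^ 2 * c ^ 2 / (16 * Λ ^ 2)) := by field_simp; norm_num
        _ ≤ _ := by gcongr
    calc _ ≤ (2 : ℝ) * 2 ^ n * (1 / 2 ^ (n + n + 2)) := by
          gcongr
          exact (Real.exp_le_exp.2 (neg_le_neg hx)).trans (hpow _)
      _ = _ := by field_simp; ring
  calc (B.card : ℝ) ≤ (2 ^ k) ^ m * (1 / 2 ^ n / 2) + (2 ^ k) ^ m * (1 / 2 ^ n / 2) :=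
        hcard.trans (add_le_add (h1.trans (by gcongr)) (h2.trans (by gcongr)))
    _ = _ := by ring

end Sparsifier

/-! ### Coins -/

/-- A finite sequence of coins, continued by `false`. -/
def padCoins {T : ℕ} (ω : Fin T → Bool) (j : ℕ) : Bool := if h : j < T then ω ⟨j, h⟩ else false

/-- The coins `i + m * l` with `i < m`, `l < k` are exactly the first `k * m`, and the remaining
ones are free. -/
theorem card_coins {m k T : ℕ} (hT : k * m ≤ T) (Q : (Fin m → Fin k → Bool) → Prop) :
    Nat.card {ω : Fin T → Bool // Q fun i l => padCoins ω (i + m * l)}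
      = Nat.card {x // Q x} * 2 ^ (T - k * m) := by
  obtain ⟨R, rfl⟩ := Nat.exists_eq_add_of_le hT
  let E : (Fin m → Fin k → Bool) × (Fin R → Bool) ≃ (Fin (k * m + R) → Bool) :=
    (((Equiv.piComm fun _ _ => Bool).trans ((Equiv.curry _ _ _).symm.trans
      (finProdFinEquiv.arrowCongr (Equiv.refl Bool)))).prodCongr (Equiv.refl _)).trans
      (Fin.appendEquiv _ _)
  have hE : ∀ y (i : Fin m) (l : Fin k), padCoins (E y) (i + m * l) = y.1 i l := fun y i l => by
    have hlt : (i : ℕ) + m * l < k * m := (finProdFinEquiv (l, i)).2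
    have hcast : (⟨i + m * l, by omega⟩ : Fin (k * m + R))
        = Fin.castAdd R (finProdFinEquiv (l, i)) := rfl
    rw [padCoins, dif_pos (by omega), hcast]
    simp [E, Fin.appendEquiv]
  rw [← Nat.card_congr (E.subtypeEquiv (p := fun y => Q y.1) fun y => by simp only [hE]),
    Nat.card_congr (Equiv.prodSubtypeFstEquivSubtypeProd (p := Q)), Nat.card_prod]
  simp

end QuantumMaxCSP

namespace RealRAM

/-! ### Total correctness with a time bound -/

/-- Started with `p` on top of the stack in a memory satisfying `P`, the machine removes `p` from
the stack within `t` steps, leaving a memory that satisfies `Q`. -/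
def Triple (ω : ℕ → Bool) (P : Store → Prop) (p : Program) (Q : Store → Prop) (t : ℕ) : Prop :=
  ∀ s, P s → ∃ s', Q s' ∧ ∃ t' ≤ t, ∀ K, (step ω)^[t'] ⟨p :: K, s⟩ = ⟨K, s'⟩

section Rules

variable {ω : ℕ → Bool} {P Q R : Store → Prop} {p q : Program} {t u : ℕ}

theorem Triple.mono {P' Q' : Store → Prop} (h : Triple ω P p Q t) (hP : ∀ s, P' s → P s)
    (hQ : ∀ s, Q s → Q' s) (ht : t ≤ u) : Triple ω P' p Q' u := fun s hs => by
  obtain ⟨s', hs', t', ht', h'⟩ := h s (hP s hs)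
  exact ⟨s', hQ s' hs', t', ht'.trans ht, h'⟩

theorem Triple.skip (h : ∀ s, P s → Q s) : Triple ω P .skip Q 1 :=
  fun s hs => ⟨s, h s hs, 1, le_rfl, fun _ => rfl⟩

theorem Triple.instr {i : Instr} (h : ∀ s, P s → Q (i.exec ω s)) : Triple ω P (.instr i) Q 1 :=
  fun s hs => ⟨_, h s hs, 1, le_rfl, fun _ => rfl⟩

theorem Triple.seq (hp : Triple ω P p Q t) (hq : Triple ω Q q R u) :
    Triple ω P (.seq p q) R (t + u + 1) := fun s hs => by
  obtain ⟨s₁, h₁, t₁, ht₁, e₁⟩ := hp s hs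
  obtain ⟨s₂, h₂, t₂, ht₂, e₂⟩ := hq s₁ h₁
  refine ⟨s₂, h₂, t₂ + t₁ + 1, by omega, fun K => ?_⟩
  rw [Function.iterate_succ_apply, Function.iterate_add_apply]
  change (step ω)^[t₂] ((step ω)^[t₁] ⟨p :: q :: K, s⟩) = _
  rw [e₁, e₂]

theorem Triple.ite {b : Test} (hp : Triple ω (fun s => P s ∧ b.Holds s) p Q t)
    (hq : Triple ω (fun s => P s ∧ ¬ b.Holds s) q Q t) :
    Triple ω P (.ite b p q) Q (t + 1) := fun s hs => by
  by_cases hb : b.Holds s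
  · obtain ⟨s', h', t', ht', e⟩ := hp s ⟨hs, hb⟩
    refine ⟨s', h', t' + 1, by omega, fun K => ?_⟩
    rw [Function.iterate_succ_apply, step, if_pos hb, e]
  · obtain ⟨s', h', t', ht', e⟩ := hq s ⟨hs, hb⟩
    refine ⟨s', h', t' + 1, by omega, fun K => ?_⟩
    rw [Function.iterate_succ_apply, step, if_neg hb, e]

theorem Triple.loop {b : Test} {N : ℕ} (I : ℕ → Store → Prop)
    (hb : ∀ j s, I j s → (b.Holds s ↔ j < N))
    (hp : ∀ j < N, Triple ω (I j) p (I (j + 1)) t) :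
    Triple ω (I 0) (.loop b p) (I N) (N * (t + 1) + 1) := by
  -- Induction on the number `d` of remaining iterations; each costs one test and one body, and the
  -- final failing test gives the extra `1`.
  have key : ∀ d j, j + d = N → Triple ω (I j) (.loop b p) (I N) (d * (t + 1) + 1) := by
    intro d
    induction d with
    | zero =>
      intro j hj s hs
      obtain rfl : j = N := hj
      refine ⟨s, hs, 1, by omega, fun K => ?_⟩
      have hnot : ¬ b.Holds s := by rw [hb j s hs]; exact lt_irrefl j
      rw [Function.iterate_one, step, if_neg hnot]
    | succ d ih =>
      intro j hj s hs
      obtain ⟨s₁, h₁, t₁, ht₁, e₁⟩ := hp j (by omega) s hs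
      obtain ⟨s₂, h₂, t₂, ht₂, e₂⟩ := ih (j + 1) (by omega) s₁ h₁
      refine ⟨s₂, h₂, t₂ + t₁ + 1, by rw [Nat.succ_mul]; omega, fun K => ?_⟩
      have hyes : b.Holds s := (hb j s hs).2 (by omega)
      rw [Function.iterate_succ_apply, step, if_pos hyes, Function.iterate_add_apply, e₁, e₂]
  exact key N 0 (zero_add N)

/-- A sequence of instructions. -/
def block : List Instr → Program
  | [] => .skip
  | i :: l => .seq (.instr i) (block l)

theorem Triple.block (l : List Instr)
    (h : ∀ s, P s → Q (l.foldl (fun s i => i.exec ω s) s)) :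
    Triple ω P (block l) Q (2 * l.length + 1) := by
  induction l generalizing P with
  | nil => exact Triple.skip h
  | cons i l ih =>
    refine ((Triple.instr (Q := fun s' => ∃ s, P s ∧ s' = i.exec ω s) fun s hs =>
      ⟨s, hs, rfl⟩).seq (ih (P := fun s' => ∃ s, P s ∧ s' = i.exec ω s) ?_)).mono
        (fun _ h => h) (fun _ h => h) (by rw [List.length_cons]; omega)
    rintro _ ⟨s, hs, rfl⟩
    exact h s hs

theorem Triple.exists_run {P : Program} {s : Store} {Q : Store → Prop} {T : ℕ} {ω : Fin T → Bool}
    (h : Triple (fun k => if h : k < T then ω ⟨k, h⟩ else false) (fun s' => s' = s) P Q T) :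
    (run P s T ω).Halted ∧ Q (run P s T ω).store := by
  obtain ⟨s', hs', t', ht', e⟩ := h s rfl
  have hrun : run P s T ω = ⟨[], s'⟩ := by
    obtain ⟨d, hd⟩ := Nat.exists_eq_add_of_le' ht'
    rw [run]
    generalize (fun k => if h : k < T then ω ⟨k, h⟩ else false) = ω' at e ⊢
    rw [hd, Function.iterate_add_apply, e]
    exact Function.iterate_fixed rfl d
  rw [hrun]
  exact ⟨rfl, hs'⟩

end Rules

end RealRAM

namespace QuantumMaxCSP

open RealRAM

/-! ### The sampling program -/

/-- Computes the threshold `C n / ε²`, the expected sample size `m` and the constant `1 / 2`. -/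
def setupProgram (C : ℕ) : Program :=
  block [.setReg 6 1, .ofReg ⟨4, 3⟩ 0, .setReal ⟨6, 3⟩ C, .opReal .mul ⟨4, 3⟩ ⟨4, 3⟩ ⟨6, 3⟩,
    .opReal .div ⟨4, 3⟩ ⟨4, 3⟩ ⟨0, 3⟩, .opReal .div ⟨4, 3⟩ ⟨4, 3⟩ ⟨0, 3⟩, .ofReg ⟨5, 3⟩ 1,
    .setReal ⟨7, 3⟩ (1 / 2)]

/-- Sets all weights to `1`. -/
def initWeightsProgram : Program :=
  .loop (.regLt 5 1) (block [.setReal ⟨3, 5⟩ 1, .addReg 5 5 6])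

/-- Doubles or deletes every weight, according to a coin flip. -/
def flipProgram : Program :=
  .loop (.regLt 5 1) (.seq (.instr (.flip 7))
    (.seq (.ite (.regLt 3 7) (.instr (.opReal .add ⟨3, 5⟩ ⟨3, 5⟩ ⟨3, 5⟩))
      (.instr (.setReal ⟨3, 5⟩ 0))) (.instr (.addReg 5 5 6))))

/-- One round of halving, if the expected sample size exceeds the threshold. -/
def roundProgram : Program :=
  .seq (.instr (.addReg 4 4 6)) (.ite (.realLt ⟨4, 3⟩ ⟨5, 3⟩)
    (.seq (block [.opReal .mul ⟨5, 3⟩ ⟨5, 3⟩ ⟨7, 3⟩, .setReg 5 0]) flipProgram) .skip)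

/-- Repeatedly halves the set of terms until its expected size is at most `C n / ε²`; the sample is
empty when `ε ≥ 1 / 2`. -/
def sampleProgram (C : ℕ) : Program :=
  .seq (setupProgram C) (.ite (.realLt ⟨0, 3⟩ ⟨7, 3⟩)
    (.seq initWeightsProgram (.loop (.regLt 4 1) roundProgram)) .skip)

open Classical in
/-- The number of halvings after `j` rounds. -/
def halvings (m : ℕ) (τ : ℝ) : ℕ → ℕ
  | 0 => 0
  | j + 1 => if τ < m / 2 ^ halvings m τ j then halvings m τ j + 1 else halvings m τ j

/-- The weight of term `a` after `k` halvings, in which it used the coins `a + m l` with `l < k`. -/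
def coinWeight (m : ℕ) (ω : ℕ → Bool) (k a : ℕ) : ℝ :=
  if ∀ l < k, ω (a + m * l) = true then 2 ^ k else 0

theorem coinWeight_succ (m : ℕ) (ω : ℕ → Bool) (k a : ℕ) :
    coinWeight m ω (k + 1) a
      = if ω (a + m * k) = true then coinWeight m ω k a + coinWeight m ω k a else 0 := by
  unfold coinWeight
  simp only [Nat.forall_lt_succ_right]
  by_cases h2 : ω (a + m * k) = true
  · by_cases h1 : ∀ l < k, ω (a + m * l) = true
    · rw [if_pos ⟨h1, h2⟩, if_pos h2, if_pos h1, pow_succ, mul_two]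
    · rw [if_neg fun h => h1 h.1, if_pos h2, if_neg h1, add_zero]
  · rw [if_neg fun h => h2 h.2, if_neg h2]

/-- The memory of the sampling program after the setup: `j` is the round, `q` the expected sample
size, `b` the number of coins used, and `f` the weights. -/
structure Mem (m : ℕ) (τ : ℝ) (j : ℕ) (q : ℝ) (b : ℕ) (f : ℕ → ℝ) (s : Store) : Prop where
  reg_one : s.reg 1 = m
  -- The constant `0`, used both as the index of every scalar cell and as the comparand in the coin
  -- test.
  reg_three : s.reg 3 = 0
  reg_four : s.reg 4 = j
  reg_six : s.reg 6 = 1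
  real_four : s.real 4 0 = τ
  real_five : s.real 5 0 = q
  real_seven : s.real 7 0 = 1 / 2
  coins : s.coins = b
  weights : ∀ a < m, s.real 3 a = f a

section Program

variable {ω : ℕ → Bool} {m : ℕ} {τ : ℝ}

theorem initWeightsProgram_triple :
    Triple ω (fun s => Mem m τ 0 m 0 (fun _ => 0) s ∧ s.reg 5 = 0) initWeightsProgram
      (Mem m τ 0 m 0 (fun _ => 1)) (m * 6 + 1) := by
  have h := Triple.loop (ω := ω) (b := .regLt 5 1) (N := m) (t := 5)
    (p := block [.setReal ⟨3, 5⟩ 1, .addReg 5 5 6])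
    (fun i s => Mem m τ 0 m 0 (fun a => if a < i then 1 else 0) s ∧ s.reg 5 = i)
    (fun i s hs => by simp [Test.Holds, hs.1.reg_one, hs.2])
    (fun i hi => Triple.block _ fun s ⟨hs, h5⟩ => by
      obtain ⟨h1, h3, h4, h6, r4, r5, r7, hc, hw⟩ := hs
      refine ⟨⟨?_, ?_, ?_, ?_, ?_, ?_, ?_, ?_, fun a ha => ?_⟩, ?_⟩ <;>
        simp [Instr.exec, Store.setReal, Store.setReg, *]
      rw [Function.update_apply, hw a ha]
      split_ifs <;> first | rfl | omega)
  refine h.mono (fun s hs => by simpa using hs) (fun s hs => ?_) le_rfl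
  obtain ⟨⟨h1, h3, h4, h6, r4, r5, r7, hc, hw⟩, -⟩ := hs
  exact ⟨h1, h3, h4, h6, r4, r5, r7, hc, fun a ha => by rw [hw a ha, if_pos ha]⟩

theorem flipProgram_triple (j k : ℕ) (q : ℝ) :
    Triple ω (fun s => Mem m τ j q (m * k) (coinWeight m ω k) s ∧ s.reg 5 = 0) flipProgram
      (Mem m τ j q (m * (k + 1)) (coinWeight m ω (k + 1))) (m * 7 + 1) := by
  have h := Triple.loop (ω := ω) (b := .regLt 5 1) (N := m) (t := 6)
    (p := .seq (.instr (.flip 7))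
      (.seq (.ite (.regLt 3 7) (.instr (.opReal .add ⟨3, 5⟩ ⟨3, 5⟩ ⟨3, 5⟩))
        (.instr (.setReal ⟨3, 5⟩ 0))) (.instr (.addReg 5 5 6))))
    -- Loop invariant: the first `i` terms have used their new coin, the others still carry the old
    -- weight.
    (fun i s => Mem m τ j q (m * k + i)
      (fun a => if a < i then coinWeight m ω (k + 1) a else coinWeight m ω k a) s ∧ s.reg 5 = i)
    (fun i s hs => by simp [Test.Holds, hs.1.reg_one, hs.2])
    (fun i hi => by
      refine (Triple.seq (Q := fun s => (Mem m τ j q (m * k + (i + 1))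
        (fun a => if a < i then coinWeight m ω (k + 1) a else coinWeight m ω k a) s ∧ s.reg 5 = i) ∧
          s.reg 7 = if ω (i + m * k) = true then 1 else 0) (Triple.instr fun s ⟨hs, h5⟩ => ?_)
        (Triple.seq (Q := fun s => Mem m τ j q (m * k + (i + 1))
          (fun a => if a < i + 1 then coinWeight m ω (k + 1) a else coinWeight m ω k a) s
            ∧ s.reg 5 = i) (Triple.ite (Triple.instr fun s ⟨⟨⟨hs, h5⟩, h7⟩, hb⟩ => ?_)
            (Triple.instr fun s ⟨⟨⟨hs, h5⟩, h7⟩, hb⟩ => ?_)) (Triple.instr fun s ⟨hs, h5⟩ => ?_)))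
      · obtain ⟨h1, h3, h4, h6, r4, r5, r7, hc, hw⟩ := hs
        refine ⟨⟨⟨?_, ?_, ?_, ?_, ?_, ?_, ?_, ?_, fun a ha => ?_⟩, ?_⟩, ?_⟩ <;>
          simp [Instr.exec, Store.setReg, add_assoc, add_comm i, *]
      · obtain ⟨h1, h3, h4, h6, r4, r5, r7, hc, hw⟩ := hs
        have hω : ω (i + m * k) = true := by
          by_contra hω
          simp [Test.Holds, h3, h7, hω] at hb
        refine ⟨⟨?_, ?_, ?_, ?_, ?_, ?_, ?_, ?_, fun a ha => ?_⟩, ?_⟩ <;>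
          simp [Instr.exec, Store.setReal, Store.getReal, RealOp.eval, *]
        rw [Function.update_apply, hw a ha]
        rcases lt_trichotomy a i with hai | rfl | hai
        · rw [if_neg hai.ne, if_pos hai, if_pos (by omega)]
        · rw [if_pos rfl, if_pos (by omega), coinWeight_succ, if_pos hω]
        · rw [if_neg hai.ne', if_neg (by omega), if_neg (by omega)]
      · obtain ⟨h1, h3, h4, h6, r4, r5, r7, hc, hw⟩ := hs
        have hω : ¬ ω (i + m * k) = true := by
          intro hω
          simp [Test.Holds, h3, h7, hω] at hb
        refine ⟨⟨?_, ?_, ?_, ?_, ?_, ?_, ?_, ?_, fun a ha => ?_⟩, ?_⟩ <;>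
          simp [Instr.exec, Store.setReal, *]
        rw [Function.update_apply, hw a ha]
        rcases lt_trichotomy a i with hai | rfl | hai
        · rw [if_neg hai.ne, if_pos hai, if_pos (by omega)]
        · rw [if_pos rfl, if_pos (by omega), coinWeight_succ, if_neg hω]
        · rw [if_neg hai.ne', if_neg (by omega), if_neg (by omega)]
      · obtain ⟨h1, h3, h4, h6, r4, r5, r7, hc, hw⟩ := hs
        refine ⟨⟨?_, ?_, ?_, ?_, ?_, ?_, ?_, ?_, fun a ha => ?_⟩, ?_⟩ <;>
          simp [Instr.exec, Store.setReg, *])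
  refine h.mono (fun s hs => by simpa using hs) (fun s hs => ?_) le_rfl
  obtain ⟨⟨h1, h3, h4, h6, r4, r5, r7, hc, hw⟩, -⟩ := hs
  exact ⟨h1, h3, h4, h6, r4, r5, r7, by rw [hc]; ring, fun a ha => by rw [hw a ha, if_pos ha]⟩

/-- The memory after `j` rounds. -/
def RoundMem (ω : ℕ → Bool) (m : ℕ) (τ : ℝ) (j : ℕ) : Store → Prop :=
  Mem m τ j (m / 2 ^ halvings m τ j) (m * halvings m τ j) (coinWeight m ω (halvings m τ j))

theorem roundProgram_triple (j : ℕ) :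
    Triple ω (RoundMem ω m τ j) roundProgram (RoundMem ω m τ (j + 1)) (m * 7 + 10) := by
  set k := halvings m τ j with hk
  refine (Triple.seq (t := 1) (u := 5 + (m * 7 + 1) + 1 + 1)
    (Q := Mem m τ (j + 1) (m / 2 ^ k) (m * k) (coinWeight m ω k)) (Triple.instr fun s hs => ?count)
    (Triple.ite (t := 5 + (m * 7 + 1) + 1) (Triple.seq (t := 5) (u := m * 7 + 1)
      -- The outcome of the test is kept in the assertion, since it identifies `halvings m τ (j +
      -- 1)` as `k + 1` after the flips.
      (Q := fun s => (Mem m τ (j + 1) (m / 2 ^ (k + 1)) (m * k) (coinWeight m ω k) s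
        ∧ s.reg 5 = 0) ∧ τ < m / 2 ^ k)
      (Triple.block _ fun s hs => ?halve) ?flips) ((Triple.skip fun s ⟨hs, hb⟩ => ?skip).mono
        (fun _ h => h) (fun _ h => h) (by omega)))).mono
        (fun _ h => h) (fun _ h => h) (by omega)
  case count =>
    obtain ⟨h1, h3, h4, h6, r4, r5, r7, hc, hw⟩ := hs
    refine ⟨?_, ?_, ?_, ?_, ?_, ?_, ?_, ?_, fun a ha => ?_⟩ <;>
      simp [Instr.exec, Store.setReg, *]
  case halve =>
    obtain ⟨hs, hb⟩ := hs
    obtain ⟨h1, h3, h4, h6, r4, r5, r7, hc, hw⟩ := hs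
    simp only [Test.Holds, Store.getReal, h3, r4, r5] at hb
    refine ⟨⟨⟨?_, ?_, ?_, ?_, ?_, ?_, ?_, ?_, fun a ha => ?_⟩, ?_⟩, hb⟩ <;>
      simp [Instr.exec, Store.setReg, Store.setReal, Store.getReal, RealOp.eval, pow_succ,
        div_eq_mul_inv, *]
    ring
  case flips =>
    intro s hs
    have hkk : halvings m τ (j + 1) = k + 1 := by rw [halvings, ← hk, if_pos hs.2]
    rw [RoundMem, hkk]
    exact flipProgram_triple (j + 1) k (m / 2 ^ (k + 1)) s hs.1
  case skip =>
    have hb' : ¬ τ < m / 2 ^ k := by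
      simpa only [Test.Holds, Store.getReal, hs.reg_three, hs.real_four, hs.real_five] using hb
    have hkk : halvings m τ (j + 1) = k := by rw [halvings, ← hk, if_neg hb']
    rw [RoundMem, hkk]
    exact hs

theorem sampleProgram_triple {n r : ℕ} (H : Instance n r m) (ε : ℝ) (C : ℕ) :
    Triple ω (fun s => s = input H ε) (sampleProgram C)
      (fun s => (ε < 1 / 2 → ∀ a < m,
        s.real 3 a = coinWeight m ω (halvings m (C * n / ε ^ 2) m) a) ∧
        (1 / 2 ≤ ε → ∀ a < m, s.real 3 a = 0)) (m * (m * 7 + 17) + 22) := by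
  set τ : ℝ := C * n / ε ^ 2 with hτ
  refine (Triple.seq (t := 17) (u := m * 6 + 1 + (m * (m * 7 + 10 + 1) + 1) + 1 + 1)
    (Q := fun s => (Mem m τ 0 m 0 (fun _ => 0) s ∧ s.reg 5 = 0) ∧ s.real 0 0 = ε)
    (Triple.block _ fun s hs => ?_) (Triple.ite (Triple.seq
      (Q := fun s => RoundMem ω m τ 0 s ∧ ε < 1 / 2) ?_ ?_)
      ((Triple.skip fun s ⟨hs, hb⟩ => ?_).mono (fun _ h => h) (fun _ h => h) (by omega)))).mono
      (fun _ h => h) (fun _ h => h) (by ring_nf; omega)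
  · subst hs
    refine ⟨⟨⟨?_, ?_, ?_, ?_, ?_, ?_, ?_, ?_, fun a ha => ?_⟩, ?_⟩, ?_⟩ <;>
      simp [Instr.exec, Store.setReg, Store.setReal, Store.getReal, RealOp.eval, input]
    rw [hτ]
    ring
  · intro s ⟨⟨hs, h0⟩, hb⟩
    simp only [Test.Holds, Store.getReal, hs.1.reg_three, hs.1.real_seven, h0] at hb
    obtain ⟨s', hs', h'⟩ := initWeightsProgram_triple (ω := ω) s hs
    refine ⟨s', ⟨?_, hb⟩, h'⟩
    have hw : coinWeight m ω 0 = fun _ => 1 := by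
      funext a
      simp [coinWeight]
    simpa [RoundMem, halvings, hw] using hs'
  · intro s ⟨hs, hε⟩
    have h := Triple.loop (ω := ω) (b := .regLt 4 1) (N := m) (RoundMem ω m τ)
      (fun j s hs => by simp [Test.Holds, hs.reg_one, hs.reg_four])
      (fun j _ => roundProgram_triple j)
    obtain ⟨s', hs', h'⟩ := h s hs
    exact ⟨s', ⟨fun _ => hs'.weights, fun h => absurd hε (not_lt.2 h)⟩, h'⟩
  · simp only [Test.Holds, Store.getReal, hs.1.1.reg_three, hs.1.1.real_seven, hs.2] at hb
    exact ⟨fun h => absurd h hb, fun _ => hs.1.1.weights⟩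

end Program

open RealRAM

/-! ### Number of halvings, and success probability of the program -/

theorem halvings_le (m : ℕ) (τ : ℝ) (j : ℕ) : halvings m τ j ≤ j := by
  induction j with
  | zero => exact le_rfl
  | succ j ih => rw [halvings]; split_ifs <;> omega

/-- A halving takes place only above `τ`, so it cannot bring the expected size to `τ / 2` or below.
-/
theorem halvings_eq_zero_or_lt (m : ℕ) (τ : ℝ) (j : ℕ) :
    halvings m τ j = 0 ∨ τ / 2 < m / 2 ^ halvings m τ j := by
  induction j with
  | zero => exact Or.inl rfl
  | succ j ih =>
    rw [halvings]
    split_ifs with h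
    · right
      rw [pow_succ, ← div_div]
      linarith
    · exact ih

/-- Either all `m` rounds halve, and `m / 2ᵐ ≤ 1`, or some test fails and the expected size stays at
most `τ` from then on. Thus `m` rounds suffice for every `ε`. -/
theorem div_two_pow_halvings_le {m : ℕ} {τ : ℝ} (hτ : 1 ≤ τ) :
    (m : ℝ) / 2 ^ halvings m τ m ≤ τ := by
  have key : ∀ j, halvings m τ j = j ∨ (m : ℝ) / 2 ^ halvings m τ j ≤ τ := by
    intro j
    induction j with
    | zero => exact Or.inl rfl
    | succ j ih =>
      rw [halvings]
      split_ifs with h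
      · exact Or.inl (by rw [ih.resolve_right (not_le.2 h)])
      · exact Or.inr (not_lt.1 h)
  rcases key m with h | h
  · rw [h]
    refine le_trans ?_ hτ
    rw [div_le_one (by positivity)]
    exact_mod_cast Nat.lt_two_pow_self.le
  · exact h

theorem coinWeight_padCoins {m T : ℕ} (ω : Fin T → Bool) (k : ℕ) (i : Fin m) :
    coinWeight m (padCoins ω) k i
      = sampleWeights (fun (i : Fin m) (l : Fin k) => padCoins ω (i + m * l)) i := by
  unfold coinWeight sampleWeights
  simp only [Fin.forall_iff]

theorem card_isSparsifier_ge {n r m : ℕ} {H : Instance n r m} {Λ c ε : ℝ} {C : ℕ} (hn : 0 < n)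
    (hc : 0 < c) (hcΛ : c ≤ Λ) (hΛ : EigenvaluesLE H Λ) (hε0 : 0 < ε) (hε1 : ε ≤ 1)
    (hopt : c * m ≤ opt (ham H)) (hC1 : 1 ≤ C) (hC : 128 * Λ ^ 2 / c ^ 2 ≤ C) :
    (1 - 1 / 2 ^ n) * (2 ^ (halvings m (C * n / ε ^ 2) m * m) : ℝ) ≤
      Nat.card {x : Fin m → Fin (halvings m (C * n / ε ^ 2) m) → Bool //
        IsSparsifier H (4 * C) ε ({i | sampleWeights x i ≠ 0} : Finset (Fin m))
          (sampleWeights x)} := by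
  classical
  set τ : ℝ := C * n / ε ^ 2 with hτ
  set k := halvings m τ m with hk
  have hC1' : (1 : ℝ) ≤ C := by exact_mod_cast hC1
  have hn1 : (1 : ℝ) ≤ n := by exact_mod_cast hn
  have hτ1 : 1 ≤ τ := by
    rw [hτ, le_div_iff₀ (by positivity)]
    have : ε ^ 2 ≤ 1 := pow_le_one₀ hε0.le hε1
    nlinarith
  have hk1 : (m : ℝ) / 2 ^ k ≤ τ := div_two_pow_halvings_le hτ1
  set Q : (Fin m → Fin k → Bool) → Prop := fun x =>
    IsSparsifier H (4 * C) ε ({i | sampleWeights x i ≠ 0} : Finset (Fin m)) (sampleWeights x)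
  have hbad : ((Finset.univ.filter fun x => ¬ Q x).card : ℝ) ≤ (2 ^ k) ^ m / 2 ^ n := by
    -- Without halvings all weights are `1` and no sample fails; otherwise the probabilistic bound
    -- applies.
    rcases halvings_eq_zero_or_lt m τ m with h0 | hlt
    · have hall : ∀ x, Q x := fun x => by
        refine isSparsifier_one hc.le hε0 hε1 hopt ?_ fun i => ?_
        · have : (m : ℝ) ≤ τ := by rwa [hk, h0, pow_zero, div_one] at hk1
          calc (m : ℝ) ≤ τ := this
            _ ≤ 4 * τ := by linarith
            _ = _ := by rw [hτ]; ring
        · have h0' : k = 0 := h0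
          have hall : ∀ l, x i l = true := fun l => absurd l.2 (by omega)
          rw [sampleWeights, if_pos hall, h0', pow_zero]
      have : (Finset.univ.filter fun x => ¬ Q x) = ∅ :=
        Finset.filter_eq_empty_iff.2 fun x _ => not_not.2 (hall x)
      rw [this, Finset.card_empty, Nat.cast_zero]
      positivity
    · exact card_not_isSparsifier_le hn hc hcΛ hΛ hε0 hε1 hopt hC1' hC hk1 hlt.le
  have htot : ((Finset.univ.filter fun x => Q x).card : ℝ)
      + (Finset.univ.filter fun x => ¬ Q x).card = (2 ^ k) ^ m := by
    rw [← Nat.cast_add, Finset.card_filter_add_card_filter_not, Finset.card_univ]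
    simp
  rw [Nat.card_eq_fintype_card, Fintype.card_subtype, pow_mul]
  have : (1 - 1 / 2 ^ n) * ((2 : ℝ) ^ k) ^ m = (2 ^ k) ^ m - (2 ^ k) ^ m / 2 ^ n := by ring
  linarith

theorem sampleProgram_solvesInTime {n r m : ℕ} {H : Instance n r m} {Λ c ε : ℝ} {C : ℕ}
    (hc : 0 < c) (hcΛ : c ≤ Λ) (hΛ : EigenvaluesLE H Λ) (hε : 0 < ε)
    (hopt : c * m ≤ opt (ham H)) (hC1 : 1 ≤ C) (hC : 128 * Λ ^ 2 / c ^ 2 ≤ C) :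
    SolvesInTime (sampleProgram C) (input H ε) (22 * (n + m + 1) ^ 2) (1 - 1 / 2 ^ n)
      (fun s => IsSparsifier H (4 * C) ε (outputSet m s) (outputWeights m s)) := by
  set T := 22 * (n + m + 1) ^ 2 with hT
  have hmT : m * (m * 7 + 17) + 22 ≤ T := by
    calc m * (m * 7 + 17) + 22 ≤ 22 * (m + 1) ^ 2 := by nlinarith
      _ ≤ T := Nat.mul_le_mul_left 22 (Nat.pow_le_pow_left (by omega) 2)
  have hrun := fun ω : Fin T → Bool => Triple.exists_run
    ((sampleProgram_triple (ω := padCoins ω) H ε C).mono (fun _ h => h) (fun _ h => h) hmT)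
  refine ⟨fun ω => (hrun ω).1, ?_⟩
  -- For `n = 0` the required probability is `0`.
  rcases Nat.eq_zero_or_pos n with rfl | hn
  · simp only [pow_zero, div_one, sub_self]
    positivity
  rw [le_div_iff₀ (by positivity)]
  rcases le_or_gt (1 / 2) ε with hε2 | hε2
  · have hgood : ∀ ω : Fin T → Bool, IsSparsifier H (4 * C) ε
        (outputSet m (run (sampleProgram C) (input H ε) T ω).store)
        (outputWeights m (run (sampleProgram C) (input H ε) T ω).store) := fun ω =>
      isSparsifier_zero H (by positivity) hε2 fun i => (hrun ω).2.2 hε2 i i.2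
    rw [Nat.card_congr (Equiv.subtypeUnivEquiv hgood)]
    have h2 : (0 : ℝ) ≤ 1 / 2 ^ n * 2 ^ T := by positivity
    simp only [Nat.card_eq_fintype_card, Fintype.card_fun, Fintype.card_bool, Fintype.card_fin,
      Nat.cast_pow, Nat.cast_ofNat]
    linarith
  · set k := halvings m (C * n / ε ^ 2) m with hk
    have hkT : k * m ≤ T := by
      have := Nat.mul_le_mul_right m (halvings_le m (C * n / ε ^ 2) m)
      nlinarith
    have hout : ∀ ω : Fin T → Bool,
        outputWeights m (run (sampleProgram C) (input H ε) T ω).store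
          = sampleWeights fun (i : Fin m) (l : Fin k) => padCoins ω (i + m * l) := fun ω => by
      funext i
      rw [← coinWeight_padCoins]
      exact (hrun ω).2.1 hε2 i i.2
    have hcard := card_coins hkT fun x => IsSparsifier H (4 * C) ε
      ({i | sampleWeights x i ≠ 0} : Finset (Fin m)) (sampleWeights x)
    simp only [outputSet, hout]
    rw [hcard, Nat.cast_mul, Nat.cast_pow, Nat.cast_ofNat]
    have hge := card_isSparsifier_ge hn hc hcΛ hΛ hε (by linarith) hopt hC1 hC
    calc (1 - 1 / 2 ^ n) * (2 : ℝ) ^ T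
        = (1 - 1 / 2 ^ n) * (2 : ℝ) ^ (k * m) * 2 ^ (T - k * m) := by
          rw [mul_assoc, ← pow_add, Nat.add_sub_cancel' hkT]
      _ ≤ _ := mul_le_mul_of_nonneg_right hge (by positivity)

/-- The state space is one-dimensional, so all unit vectors have the same energy. The size bound is
`0` here, which forces the empty set. -/
theorem isSparsifier_empty_of_no_qubits {r m : ℕ} (H : Instance 0 r m) {C ε : ℝ} (hε : 0 ≤ ε) :
    IsSparsifier H C ε ∅ (fun _ => 0) := by
  refine ⟨by simp, by simp, fun ψ hψ _ => ?_⟩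
  have hA : ham H = (((ham H default default).re : ℝ) : ℂ) • 1 := by
    ext x y
    rw [Subsingleton.elim x default, Subsingleton.elim y default, Matrix.smul_apply,
      Matrix.one_apply_eq, smul_eq_mul, mul_one]
    exact (Complex.conj_eq_iff_re.1 ((ham_posSemidef H).isHermitian.apply default default)).symm
  have hen : ∀ φ : Qubits 0, ‖φ‖ = 1 → energy (ham H) φ = (ham H default default).re :=
    fun φ hφ => by
      conv_lhs => rw [hA]
      rw [energy_smul, energy_one hφ, mul_one]
  obtain ⟨φ, hφ, hopt⟩ := exists_energy_eq_opt (ham H)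
  have h0 := opt_nonneg (ham_posSemidef H)
  rw [hen ψ hψ, ← hen φ hφ, hopt]
  nlinarith

end QuantumMaxCSP

end

theorem mainTheorem6 (Λ c : ℝ) (hc : 0 < c) :
    ∃ (C : ℝ) (P : RealRAM.Program) (K d : ℕ),
      ∀ (r n m : ℕ) (H : QuantumMaxCSP.Instance n r m) (ε : ℝ), 0 < ε →
        QuantumMaxCSP.EigenvaluesLE H Λ →
        c * m ≤ QuantumMaxCSP.opt (QuantumMaxCSP.ham H) →
        (∃ (L : Finset (Fin m)) (w : Fin m → ℝ), QuantumMaxCSP.IsSparsifier H C ε L w) ∧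
        RealRAM.SolvesInTime P (QuantumMaxCSP.input H ε) (K * (n + m + 1) ^ d) (1 - 1 / 2 ^ n)
          (fun s => QuantumMaxCSP.IsSparsifier H C ε (QuantumMaxCSP.outputSet m s)
            (QuantumMaxCSP.outputWeights m s)) := by
  -- Replacing `Λ` by `max Λ c` keeps the eigenvalue bound and provides `0 < c ≤ Λ`. The constant is
  -- a natural number because it is written into the program; the final factor `4` comes from the
  -- tail bound on the sample size.
  obtain ⟨C, hC⟩ := exists_nat_ge (128 * max Λ c ^ 2 / c ^ 2)
  refine ⟨4 * (C + 1 : ℕ), QuantumMaxCSP.sampleProgram (C + 1), 22, 2,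
    fun r n m H ε hε hΛ hopt => ?_⟩
  have hsolve := QuantumMaxCSP.sampleProgram_solvesInTime (C := C + 1) hc (le_max_right Λ c)
    (fun i k => (hΛ i k).trans (le_max_left Λ c)) hε hopt (by omega)
    (hC.trans (by push_cast; linarith))
  refine ⟨?_, hsolve⟩
  rcases Nat.eq_zero_or_pos n with rfl | hn
  · exact ⟨∅, fun _ => 0, QuantumMaxCSP.isSparsifier_empty_of_no_qubits H hε.le⟩
  · have hpos : (0 : ℝ) < 1 - 1 / 2 ^ n := by
      rw [sub_pos, div_lt_one (by positivity)]
      exact one_lt_pow₀ one_lt_two hn.ne'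
    have hcard := hpos.trans_le hsolve.2
    rw [div_pos_iff_of_pos_right (by positivity), Nat.cast_pos] at hcard
    obtain ⟨ω, hω⟩ := (Nat.card_pos_iff.1 hcard).1
    exact ⟨_, _, hω⟩
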